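/- Work over $\mathbb C$ with the quiver with one vertex and no edges ($\mathfrak{sl}_2$). For finite dimensional vector spaces $D,V$ let $\Lambda_{D,V}$ be the variety of pairs $(p,q)$, $p\colon D\to V$, $q\colon V\to D$, $pq=0$, with $G_V=GL(V)$ acting by $(gp,qg^{-1})$. Write $d=\dim D$, $v=\dim V$; all varieties carry the Zariski topology. Let $\mathfrak M^s(d,v_0,v)$ be the quotient by $G_V$ of the set of $(p,q)\in\Lambda_{D,V}$ with $p$ surjective and $\dim\ker q=v-v_0$; let $\mathcal M(d,v_0,v)$ be its set of irreducible components and $\mathcal M(d,v_0)=\bigsqcup_v\mathcal M(d,v_0,v)$. Let $D^1\subset D$ be a subspace, $d^1=\dim D^1$, $d^2=\dim D/D^1$, $\mathbf d=(d^1,d^2)$, $d=d^1+d^2$, and $\mathbf v=(v^1,v^2)\in\mathbb Z_{\ge0}^2$. The tensor product variety ${}^2\mathfrak T(d,\mathbf d,v,\mathbf v)$ is the quotient by $G_V$ of the set of $(p,q)\in\Lambda_{D,V}$ with $p$ surjective, $p(D^1)\subset q^{-1}(D^1)$, $\dim p(D^1)/(p(D^1)\cap\ker q)=v^1$ and $\dim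 V/q^{-1}(D^1)=v^2$; the multiplicity variety ${}^2\mathfrak S(d,\mathbf d,v,\mathbf v)$ is its part where $q$ is injective. Let ${}^2\mathcal T(d,\mathbf d,v,\mathbf v)$, ${}^2\mathcal S(d,\mathbf d,v,\mathbf v)$ be their sets of irreducible components and ${}^2\mathcal T(d,\mathbf d,\mathbf v)=\bigsqcup_v{}^2\mathcal T(d,\mathbf d,v,\mathbf v)$. **Theorem.** (1) $\mathfrak M^s(d,v_0,v)$ is irreducible if $v_0\le v\le d-v_0$ and empty otherwise; ${}^2\mathfrak S(d,\mathbf d,v_0,\mathbf v)$ is irreducible if $v^1+v^2\le v_0\le\min(d^2-v^2+v^1,\,d^1-v^1+v^2)$ and empty otherwise. The set $\mathcal M(d,v_0)=\{\mathfrak M^s(d,v_0,v)\mid v_0\le v\le d-v_0\}$ is a normal $\mathfrak{sl}_2$-crystal (with weight lattice $\mathbb Z$) under $$wt=d-2v,\quad \varepsilon=v-v_0,\quad \varphi=d-v-v_0,$$ $$\tilde e\,\mathfrak M^s(d,v_0,v)=\mathfrak M^s(d,v_0,v-1)\ (0\text{ if }v=v_0),\qquad \tilde f\,\mathfrak M^s(d,v_0,v)=\mathfrak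 M^s(d,v_0,v+1)\ (0\text{ if }v=d-v_0).$$ (2) There are bijections $$\alpha_2\colon{}^2\mathcal T(d,\mathbf d,\mathbf v)\to\mathcal M(d^1,v^1)\times\mathcal M(d^2,v^2),\qquad \beta_2\colon{}^2\mathcal T(d,\mathbf d,\mathbf v)\to\bigsqcup_{v_0\ge0}{}^2\mathcal S(d,\mathbf d,v_0,\mathbf v)\times\mathcal M(d,v_0)$$ such that: for components $Z_k$ of $\mathfrak M^s(d^k,v^k,u^k)$, $\alpha_2^{-1}(Z_1,Z_2)$ is the closure in ${}^2\mathfrak T(d,\mathbf d,u^1+u^2,\mathbf v)$ of the set of classes of $(p,q)$ whose restriction to $D^1,\,p(D^1)$ has class in $Z_1$ and whose induced pair on $D/D^1,\,V/p(D^1)$ has class in $Z_2$; for components $S$ of ${}^2\mathfrak S(d,\mathbf d,v_0,\mathbf v)$ and $Z$ of $\mathfrak M^s(d,v_0,v)$, $\beta_2^{-1}(S,Z)$ is the closure in ${}^2\mathfrak T(d,\mathbf d,v,\mathbf v)$ of the set of classes of $(p,q)$ with $\dim\ker q=v-v_0$, with class in $Z$, and whose induced pair on $D,\,V/\ker q$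 has class in $S$. (3) The bijection $\tau_2=\beta_2\circ\alpha_2^{-1}$ is an isomorphism of normal $\mathfrak{sl}_2$-crystals $$\tau_2\colon\ \mathcal M(d^1,v^1)\otimes\mathcal M(d^2,v^2)\ \xrightarrow{\sim}\ \bigoplus_{v_0\in\mathbb Z_{\ge0}}{}^2\mathcal S(d,\mathbf d,v_0,\mathbf v)\otimes\mathcal M(d,v_0),$$ where ${}^2\mathcal S$ is a trivial crystal ($wt=\varepsilon=\varphi=0$, $\tilde e=\tilde f=0$), and the tensor product is $A\times B$ with $wt(a,b)=wt(a)+wt(b)$, $\varepsilon(a,b)=\max(\varepsilon(a),\varepsilon(a)+\varepsilon(b)-\varphi(a))$, $\varphi(a,b)=\max(\varphi(b),\varphi(a)+\varphi(b)-\varepsilon(b))$, $\tilde e(a,b)=(\tilde ea,b)$ if $\varphi(a)\ge\varepsilon(b)$ and $(a,\tilde eb)$ otherwise, $\tilde f(a,b)=(\tilde fa,b)$ if $\varphi(a)>\varepsilon(b)$ and $(a,\tilde fb)$ otherwise. It sends the pair $(\mathfrak M^s(d^1,v^1,u^1),\mathfrak M^s(d^2,v^2,u^2))$ to $\mathfrak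 M^s(d,v_0,u^1+u^2)$ (in the summand of the unique component of ${}^2\mathfrak S(d,\mathbf d,v_0,\mathbf v)$), where $$v_0=\min(u^2+v^1,\;d^1-u^1+v^2).$$ -/

import Mathlib

open Module

noncomputable section

namespace SL2Quiver

universe u

/-! ### The Zariski topology of a finite dimensional complex vector space -/

/-- Polynomial functions on `W`: the algebra of functions generated by the linear functionals. -/
def polyFun (W : Type*) [AddCommGroup W] [Module ℂ W] : Subalgebra ℂ (W → ℂ) :=
  Algebra.adjoin ℂ (Set.range fun (l : Dual ℂ W) (w : W) => l w)

/-- The Zariski topology: the non-vanishing loci of polynomial functions are the basic open sets. -/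
abbrev zariski (W : Type*) [AddCommGroup W] [Module ℂ W] : TopologicalSpace W :=
  TopologicalSpace.generateFrom {U | ∃ f ∈ polyFun W, U = {w | f w ≠ 0}}

/-! ### ADHM data for the quiver with one vertex and no edges -/

/-- An ADHM datum on `D`, `V`: a pair of linear maps `p : D → V`, `q : V → D` with `p q = 0`
(the quiver has no edges, so there is no `x`, every subspace of `V` is a submodule, and the ADHM
equation is `p q = 0`). -/
@[ext] structure ADHM (D V : Type*) [AddCommGroup D] [Module ℂ D]
    [AddCommGroup V] [Module ℂ V] where
  p : D →ₗ[ℂ] V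
  q : V →ₗ[ℂ] D
  pq : p ∘ₗ q = 0

section ADHM

variable {D V : Type*} [AddCommGroup D] [Module ℂ D] [AddCommGroup V] [Module ℂ V]

/-- The subspace topology from the Zariski topology of `Hom(D, V) × Hom(V, D)`. -/
instance : TopologicalSpace (ADHM D V) :=
  (zariski ((D →ₗ[ℂ] V) × (V →ₗ[ℂ] D))).induced fun z => (z.p, z.q)

/-- The action `g • (p, q) = (g p, q g⁻¹)` of `G_V = GL(V)`. -/
instance : MulAction (V ≃ₗ[ℂ] V) (ADHM D V) where
  smul g z := ⟨g.toLinearMap ∘ₗ z.p, z.q ∘ₗ g.symm.toLinearMap, by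
    ext v
    have h := LinearMap.congr_fun z.pq (g.symm v)
    simp only [LinearMap.comp_apply, LinearMap.zero_apply] at h
    simp [h]⟩
  one_smul _ := rfl
  mul_smul _ _ _ := rfl

/-- The orbit space `S / G_V` of a `G_V`-invariant set `S` of ADHM data, with the quotient of the
Zariski topology. -/
def OrbitSpace (S : Set (ADHM D V)) : Type _ :=
  Quotient ((MulAction.orbitRel (V ≃ₗ[ℂ] V) (ADHM D V)).comap (Subtype.val : S → ADHM D V))

instance (S : Set (ADHM D V)) : TopologicalSpace (OrbitSpace S) :=
  inferInstanceAs (TopologicalSpace (Quotient _))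

/-- The orbit of a point of `S`. -/
def OrbitSpace.mk {S : Set (ADHM D V)} (z : ADHM D V) (hz : z ∈ S) : OrbitSpace S :=
  Quotient.mk _ ⟨z, hz⟩

/-- `z` is stable: `p(D) = V`. -/
def ADHM.Stable (z : ADHM D V) : Prop := LinearMap.range z.p = ⊤

/-- `z` is `*`-stable: `q⁻¹(0) = 0`. -/
def ADHM.CoStable (z : ADHM D V) : Prop := LinearMap.ker z.q = ⊥

/-- `dim A / (A ∩ B)`. -/
def relDim (A B : Submodule ℂ V) : ℕ := finrank ℂ (A ⧸ B.submoduleOf A)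

variable (D V) in
/-- `Λˢ_{D,V,v₀}`: the stable data with `dim q⁻¹(0) = dim V - v₀`. -/
def lambdaS (v₀ : ℕ) : Set (ADHM D V) :=
  {z | z.Stable ∧ finrank ℂ (LinearMap.ker z.q) + v₀ = finrank ℂ V}

variable (V) in
/-- `²Πˢ_{D,𝐃,V,𝐯}` for the two-step flag `𝐃 = (0 ⊆ D₁ ⊆ D)` and `𝐯 = (v₁, v₂)`: the stable data
such that `p(D₁) ⊆ q⁻¹(D₁)`, `dim p(D₁) / (p(D₁) ∩ q⁻¹(0)) = v₁` and
`dim p(D) / (p(D) ∩ q⁻¹(D₁)) = v₂`. -/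
def piS (D₁ : Submodule ℂ D) (v₁ v₂ : ℕ) : Set (ADHM D V) :=
  {z | z.Stable ∧ D₁.map z.p ≤ D₁.comap z.q ∧
    relDim (D₁.map z.p) (LinearMap.ker z.q) = v₁ ∧
    relDim (LinearMap.range z.p) (D₁.comap z.q) = v₂}

variable (V) in
/-- `²Π^{s,*s}_{D,𝐃,V,𝐯}`: the `*`-stable points of `²Πˢ_{D,𝐃,V,𝐯}`. -/
def piSS (D₁ : Submodule ℂ D) (v₁ v₂ : ℕ) : Set (ADHM D V) :=
  {z | z ∈ piS V D₁ v₁ v₂ ∧ z.CoStable}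

/-- `z₁` is (up to the choice of an identification `i` of `V₁` with `p(D₁)`) the restriction
`(p|_{D₁} : D₁ → p(D₁), q|_{p(D₁)} : p(D₁) → D₁)` of `z`. -/
def IsSub {V₁ : Type*} [AddCommGroup V₁] [Module ℂ V₁] (D₁ : Submodule ℂ D)
    (z : ADHM D V) (z₁ : ADHM D₁ V₁) : Prop :=
  ∃ i : V₁ →ₗ[ℂ] V, Function.Injective i ∧ LinearMap.range i = D₁.map z.p ∧
    i ∘ₗ z₁.p = z.p ∘ₗ D₁.subtype ∧ D₁.subtype ∘ₗ z₁.q = z.q ∘ₗ i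

/-- `z₂` is (up to the choice of an identification of `V₂` with `V / p(D₁)`) the datum
`(D / D₁ → V / p(D₁), V / p(D₁) → D / D₁)` induced by `z`. -/
def IsQuot {V₂ : Type*} [AddCommGroup V₂] [Module ℂ V₂] (D₁ : Submodule ℂ D)
    (z : ADHM D V) (z₂ : ADHM (D ⧸ D₁) V₂) : Prop :=
  ∃ π : V →ₗ[ℂ] V₂, Function.Surjective π ∧ LinearMap.ker π = D₁.map z.p ∧
    z₂.p ∘ₗ D₁.mkQ = π ∘ₗ z.p ∧ z₂.q ∘ₗ π = D₁.mkQ ∘ₗ z.q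

/-- `z₀` is (up to the choice of an identification of `T` with `V / q⁻¹(0)`) the datum
`(D → V / q⁻¹(0), V / q⁻¹(0) → D)` induced by `z`. -/
def IsRed {T : Type*} [AddCommGroup T] [Module ℂ T] (z : ADHM D V) (z₀ : ADHM D T) : Prop :=
  ∃ π : V →ₗ[ℂ] T, Function.Surjective π ∧ LinearMap.ker π = LinearMap.ker z.q ∧
    z₀.p = π ∘ₗ z.p ∧ z₀.q ∘ₗ π = z.q

end ADHM

/-! ### Quiver, tensor product and multiplicity varieties, and their irreducible components

The varieties depend on `V` only through `v = dim V`, so `V = ℂᵛ` is used. -/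

section Varieties

variable (D : Type u) [AddCommGroup D] [Module ℂ D]

/-- The variety `𝔐ˢ(d, v₀, v) = Λˢ_{D,V,v₀} / G_V`, where `d = dim D`, `v = dim V`. -/
abbrev QuiverVar (v₀ v : ℕ) : Type u := OrbitSpace (lambdaS D (Fin v → ℂ) v₀)

/-- The set `𝓜(d, v₀)`: the disjoint union over `v` of the sets of irreducible components of
`𝔐ˢ(d, v₀, v)`. -/
abbrev MComp (v₀ : ℕ) : Type u := Σ v : ℕ, irreducibleComponents (QuiverVar D v₀ v)

variable {D}
variable (D₁ : Submodule ℂ D)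

/-- The tensor product variety `²𝔗(d, 𝐝, v, 𝐯)`. -/
abbrev TensorVar (v v₁ v₂ : ℕ) : Type u := OrbitSpace (piS (Fin v → ℂ) D₁ v₁ v₂)

/-- The multiplicity variety `²𝔖(d, 𝐝, v, 𝐯)`. -/
abbrev MultVar (v v₁ v₂ : ℕ) : Type u := OrbitSpace (piSS (Fin v → ℂ) D₁ v₁ v₂)

/-- The set `²𝓣(d, 𝐝, 𝐯)`: the disjoint union over `v` of the sets of irreducible components of
`²𝔗(d, 𝐝, v, 𝐯)`. -/
abbrev TComp (v₁ v₂ : ℕ) : Type u := Σ v : ℕ, irreducibleComponents (TensorVar D₁ v v₁ v₂)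

/-- The set `²𝓢(d, 𝐝, v, 𝐯)` of irreducible components of the multiplicity variety. -/
abbrev SComp (v v₁ v₂ : ℕ) : Type u := irreducibleComponents (MultVar D₁ v v₁ v₂)

/-- A component of a tensor product variety as a subset of that variety. -/
def TComp.toSet {D₁ : Submodule ℂ D} {v₁ v₂ : ℕ} (Z : TComp D₁ v₁ v₂) :
    Σ v : ℕ, Set (TensorVar D₁ v v₁ v₂) := ⟨Z.1, Z.2.1⟩

/-- The closure, in the tensor product variety with `v = u₁ + u₂`, of the set of all classes of
`(p, q)` with `dim p(D₁) = u₁` whose restriction to `D₁` lies in the component `Z₁` of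
`𝔐ˢ(d₁, v₁, u₁)` and whose quotient lies in the component `Z₂` of `𝔐ˢ(d₂, v₂, u₂)`. -/
def alphaInv {v₁ v₂ : ℕ} (a : MComp D₁ v₁ × MComp (D ⧸ D₁) v₂) :
    Σ v : ℕ, Set (TensorVar D₁ v v₁ v₂) :=
  ⟨a.1.1 + a.2.1, closure {x | ∃ (z : ADHM D (Fin (a.1.1 + a.2.1) → ℂ))
      (hz : z ∈ piS (Fin (a.1.1 + a.2.1) → ℂ) D₁ v₁ v₂),
    x = OrbitSpace.mk z hz ∧
    (∃ (z₁ : ADHM D₁ (Fin a.1.1 → ℂ)) (h₁ : z₁ ∈ lambdaS D₁ (Fin a.1.1 → ℂ) v₁),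
      IsSub D₁ z z₁ ∧ OrbitSpace.mk z₁ h₁ ∈ a.1.2.1) ∧
    (∃ (z₂ : ADHM (D ⧸ D₁) (Fin a.2.1 → ℂ)) (h₂ : z₂ ∈ lambdaS (D ⧸ D₁) (Fin a.2.1 → ℂ) v₂),
      IsQuot D₁ z z₂ ∧ OrbitSpace.mk z₂ h₂ ∈ a.2.2.1)}⟩

/-- The closure, in the tensor product variety, of the set of all classes of `(p, q)` with
`dim q⁻¹(0) = v - v₀` which lie in the given component of `𝔐ˢ(d, v₀, v)` and whose reduction modulo
`q⁻¹(0)` lies in the given component of `²𝔖(d, 𝐝, v₀, 𝐯)`. -/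
def betaInv {v₁ v₂ : ℕ} (b : Σ v₀ : ℕ, SComp D₁ v₀ v₁ v₂ × MComp D v₀) :
    Σ v : ℕ, Set (TensorVar D₁ v v₁ v₂) :=
  ⟨b.2.2.1, closure {x | ∃ (z : ADHM D (Fin b.2.2.1 → ℂ))
      (hz : z ∈ piS (Fin b.2.2.1 → ℂ) D₁ v₁ v₂) (hm : z ∈ lambdaS D (Fin b.2.2.1 → ℂ) b.1),
    x = OrbitSpace.mk z hz ∧ OrbitSpace.mk z hm ∈ b.2.2.2.1 ∧
    (∃ (z₀ : ADHM D (Fin b.1 → ℂ)) (h₀ : z₀ ∈ piSS (Fin b.1 → ℂ) D₁ v₁ v₂),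
      IsRed z z₀ ∧ OrbitSpace.mk z₀ h₀ ∈ b.2.1.1)}⟩

variable {D₁}

/-- `α` is the first bijection `α₂ : ²𝓣(d, 𝐝, 𝐯) ≃ 𝓜(d₁, v₁) × 𝓜(d₂, v₂)`, induced by restricting
`(p, q)` to `D₁` and to `D / D₁`. -/
def IsAlpha {v₁ v₂ : ℕ} (α : TComp D₁ v₁ v₂ ≃ MComp D₁ v₁ × MComp (D ⧸ D₁) v₂) : Prop :=
  ∀ a, (α.symm a).toSet = alphaInv D₁ a

/-- `β` is the second bijection `β₂ : ²𝓣(d, 𝐝, 𝐯) ≃ ⨆_{v₀} ²𝓢(d, 𝐝, v₀, 𝐯) × 𝓜(d, v₀)`, induced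
by reducing `(p, q)` modulo `q⁻¹(0)`. -/
def IsBeta {v₁ v₂ : ℕ}
    (β : TComp D₁ v₁ v₂ ≃ Σ v₀ : ℕ, SComp D₁ v₀ v₁ v₂ × MComp D v₀) : Prop :=
  ∀ b, (β.symm b).toSet = betaInv D₁ b

end Varieties

/-! ### `𝔰𝔩₂`-crystals

The weight lattice is `ℤ`, the simple root is `2`, and `none` plays the role of `0`. -/

/-- The data of an `𝔰𝔩₂`-crystal on the set `A`. -/
structure CrystalData (A : Type*) where
  wt : A → ℤ
  ε : A → ℤ
  φ : A → ℤ
  e : A → Option A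
  f : A → Option A

/-- `g^n a`, for an operator `g : A → A ∪ {0}`. -/
def iterOp {A : Type*} (g : A → Option A) (n : ℕ) (a : A) : Option A :=
  (fun o : Option A => o.bind g)^[n] (some a)

/-- The axioms of a normal `𝔰𝔩₂`-crystal. -/
structure CrystalData.IsNormalCrystal {A : Type*} (C : CrystalData A) : Prop where
  e_spec : ∀ a b, C.e a = some b →
    C.wt b = C.wt a + 2 ∧ C.φ b = C.φ a + 1 ∧ C.ε b = C.ε a - 1
  f_spec : ∀ a b, C.f a = some b →
    C.wt b = C.wt a - 2 ∧ C.φ b = C.φ a - 1 ∧ C.ε b = C.ε a + 1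
  wt_eq : ∀ a, C.wt a = C.φ a - C.ε a
  f_iff_e : ∀ a b, C.f a = some b ↔ C.e b = some a
  ε_eq : ∀ a, ∃ n : ℕ, C.ε a = n ∧ IsGreatest {k : ℕ | iterOp C.e k a ≠ none} n
  φ_eq : ∀ a, ∃ n : ℕ, C.φ a = n ∧ IsGreatest {k : ℕ | iterOp C.f k a ≠ none} n

/-- The trivial crystal on a set. -/
def trivialCrystal (A : Type*) : CrystalData A where
  wt _ := 0
  ε _ := 0
  φ _ := 0
  e _ := none
  f _ := none

/-- The tensor product of crystals. -/
def CrystalData.tensor {A B : Type*} (X : CrystalData A) (Y : CrystalData B) :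
    CrystalData (A × B) where
  wt c := X.wt c.1 + Y.wt c.2
  ε c := max (X.ε c.1) (X.ε c.1 + Y.ε c.2 - X.φ c.1)
  φ c := max (Y.φ c.2) (X.φ c.1 + Y.φ c.2 - Y.ε c.2)
  e c := if Y.ε c.2 ≤ X.φ c.1 then (X.e c.1).map fun a => (a, c.2)
    else (Y.e c.2).map fun b => (c.1, b)
  f c := if Y.ε c.2 < X.φ c.1 then (X.f c.1).map fun a => (a, c.2)
    else (Y.f c.2).map fun b => (c.1, b)

/-- The direct sum of a family of crystals. -/
def directSumCrystal {ι : Type*} {A : ι → Type*} (X : ∀ i, CrystalData (A i)) :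
    CrystalData (Σ i, A i) where
  wt c := (X c.1).wt c.2
  ε c := (X c.1).ε c.2
  φ c := (X c.1).φ c.2
  e c := ((X c.1).e c.2).map fun a => ⟨c.1, a⟩
  f c := ((X c.1).f c.2).map fun a => ⟨c.1, a⟩

/-- A bijection is an isomorphism of crystals if it commutes with all the structure maps. -/
structure IsCrystalIso {A B : Type*} (X : CrystalData A) (Y : CrystalData B) (τ : A ≃ B) :
    Prop where
  wt : ∀ a, Y.wt (τ a) = X.wt a
  ε : ∀ a, Y.ε (τ a) = X.ε a
  φ : ∀ a, Y.φ (τ a) = X.φ a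
  e : ∀ a, Y.e (τ a) = (X.e a).map τ
  f : ∀ a, Y.f (τ a) = (X.f a).map τ

section CrystalM

variable (D : Type u) [AddCommGroup D] [Module ℂ D]

open Classical in
/-- The whole variety `𝔐ˢ(d, v₀, v)` as an element of `𝓜(d, v₀)`. (It is one as soon as
`𝔐ˢ(d, v₀, v)` is irreducible, which is the case whenever this is used below.) -/
def wholeVar (v₀ v : ℕ) : Option (MComp D v₀) :=
  if h : Set.univ ∈ irreducibleComponents (QuiverVar D v₀ v) then some ⟨v, Set.univ, h⟩ else none

/-- The crystal structure of `𝓜(d, v₀)`. -/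
def crystalM (v₀ : ℕ) : CrystalData (MComp D v₀) where
  wt Z := (finrank ℂ D : ℤ) - 2 * Z.1
  ε Z := (Z.1 : ℤ) - v₀
  φ Z := (finrank ℂ D : ℤ) - Z.1 - v₀
  e Z := if v₀ < Z.1 then wholeVar D v₀ (Z.1 - 1) else none
  f Z := if Z.1 + v₀ < finrank ℂ D then wholeVar D v₀ (Z.1 + 1) else none

end CrystalM

end SL2Quiver

end

open SL2Quiver Module

/-!
A stable datum `(p, q)` is, up to `GL(V)`, a pair `(K, t)` with `K = ker p`, `t = q p` and
`im t ⊆ K ⊆ ker t`. Such pairs are classified up to `GL(D)` by `dim K` and `rank t`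
(`exists_equiv_conj`), and a line in `End(D)` through `1` and an invertible `g` is invertible
outside a finite set. So any two points of `𝔐ˢ(d, v₀, v)` are joined by a rational curve, which makes
the variety irreducible.

The tensor product variety carries two functions, `u = dim p(D₁)` and `r = rank q`. Each level set
of either function is irreducible by the same argument with the stabilizer of `D₁` in place of
`GL(D)`: a stabilizing `g` matches `p` (respectively `q`) and the relevant diagonal blocks of `q p`,
and the remaining freedom is linear in `q` (respectively `p`), see `linked_of_subDim_eq` and
`linked_of_qRank_eq`.

No dimension count is needed to find the irreducible components. With
`M = min (v + v₁) (d₁ + v₂)` one has `u + r ≤ M` everywhere (`invariants_le`), equality is attained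
on every level set of `u` (`exists_mem_piS`), and both functions are lower semicontinuous. Hence the
locus `u + r = M` is open and dense in the level sets `u = k` and `r = M - k`, which therefore have
the same closure. If the closure of `u = k` lies in that of `u = k'`, then `k ≤ k'` and
`M - k ≤ M - k'`, so `k = k'`. The components are therefore the closures of the level sets of `u`,
and also those of the level sets of `r` (`OppositeStrata`).

The closure of `u = k` is `α₂⁻¹` of the pair with weights `(k, v - k)`, and the closure of `r = v₀`
is `β₂⁻¹` of the pair with indices `(v₀, v)`. So `τ₂` sends `(u₁, u₂)` to
`v₀ = M - u₁ = min (u₂ + v₁) (d₁ - u₁ + v₂)`. A component of a quiver or multiplicity variety is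
determined by its numerical indices, and the crystal statements become integer arithmetic.
-/

open SL2Quiver Module

namespace SL2Quiver

/-! ### Extending isomorphisms along short exact sequences -/

section LinearAlgebra

variable {A E C A' E' C' : Type*}
  [AddCommGroup A] [Module ℂ A] [AddCommGroup E] [Module ℂ E] [AddCommGroup C] [Module ℂ C]
  [AddCommGroup A'] [Module ℂ A'] [AddCommGroup E'] [Module ℂ E'] [AddCommGroup C'] [Module ℂ C']

/-- A surjection has a section that sends the image of a given subspace back into it. -/
theorem exists_section_adapted (π : E →ₗ[ℂ] C) (hπ : Function.Surjective π) (K : Submodule ℂ E) :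
    ∃ s : C →ₗ[ℂ] E, (∀ c, π (s c) = c) ∧ ∀ x ∈ K, s (π x) ∈ K := by
  obtain ⟨s₀, hs₀⟩ := π.exists_rightInverse_of_surjective (LinearMap.range_eq_top.2 hπ)
  obtain ⟨σ, hσ⟩ := (π.submoduleMap K).exists_rightInverse_of_surjective
    (LinearMap.range_eq_top.2 (π.submoduleMap_surjective K))
  obtain ⟨ρ, hρ⟩ := (K.map π).subtype.exists_leftInverse_of_injective
    (LinearMap.ker_eq_bot.2 Subtype.val_injective)
  have h0 : ∀ c, π (s₀ c) = c := fun c => LinearMap.congr_fun hs₀ c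
  have h1 : ∀ c, π (σ c : E) = c := fun c =>
    congrArg Subtype.val (LinearMap.congr_fun hσ c)
  have h2 : ∀ c : K.map π, ρ (c : C) = c := fun c => LinearMap.congr_fun hρ c
  refine ⟨K.subtype ∘ₗ σ ∘ₗ ρ + s₀ ∘ₗ (LinearMap.id - (K.map π).subtype ∘ₗ ρ), fun c => ?_,
    fun x hx => ?_⟩
  · simp [h0, h1]
  · have := h2 ⟨π x, Submodule.mem_map_of_mem hx⟩
    simp only at this
    simp [this]

/-- Isomorphisms of the outer terms of two short exact sequences lift to an isomorphism of the
middle terms. If the outer isomorphisms match the traces of two given subspaces `K`, `K'` of the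
middle terms, then the lift can be chosen to match `K` and `K'`. -/
theorem exists_lift_equiv {ι : A →ₗ[ℂ] E} {π : E →ₗ[ℂ] C} {ι' : A' →ₗ[ℂ] E'} {π' : E' →ₗ[ℂ] C'}
    (hι : Function.Injective ι) (hπ : Function.Surjective π)
    (hex : LinearMap.range ι = LinearMap.ker π)
    (hι' : Function.Injective ι') (hπ' : Function.Surjective π')
    (hex' : LinearMap.range ι' = LinearMap.ker π')
    (g₁ : A ≃ₗ[ℂ] A') (g₂ : C ≃ₗ[ℂ] C') (K : Submodule ℂ E) (K' : Submodule ℂ E')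
    (h₁ : (K.comap ι).map g₁.toLinearMap = K'.comap ι')
    (h₂ : (K.map π).map g₂.toLinearMap = K'.map π') :
    ∃ g : E ≃ₗ[ℂ] E', (∀ a, g (ι a) = ι' (g₁ a)) ∧ (∀ x, π' (g x) = g₂ (π x)) ∧
      K.map g.toLinearMap = K' := by
  obtain ⟨s, hs, hsK⟩ := exists_section_adapted π hπ K
  obtain ⟨s', hs', hsK'⟩ := exists_section_adapted π' hπ' K'
  obtain ⟨l, hl⟩ := ι.exists_leftInverse_of_injective (LinearMap.ker_eq_bot.2 hι)
  have hl' : ∀ a, l (ι a) = a := fun a => LinearMap.congr_fun hl a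
  have hπι : ∀ a, π (ι a) = 0 := fun a => by
    rw [← LinearMap.mem_ker, ← hex]; exact ⟨a, rfl⟩
  have hπι' : ∀ a, π' (ι' a) = 0 := fun a => by
    rw [← LinearMap.mem_ker, ← hex']; exact ⟨a, rfl⟩
  have hdec : ∀ x, ι (l (x - s (π x))) = x - s (π x) := fun x => by
    have : x - s (π x) ∈ LinearMap.range ι := by rw [hex, LinearMap.mem_ker]; simp [hs]
    obtain ⟨a, ha⟩ := this
    rw [← ha, hl']
  let G : E →ₗ[ℂ] E' := ι' ∘ₗ g₁.toLinearMap ∘ₗ l ∘ₗ (LinearMap.id - s ∘ₗ π) +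
    s' ∘ₗ g₂.toLinearMap ∘ₗ π
  have hG : ∀ x, G x = ι' (g₁ (l (x - s (π x)))) + s' (g₂ (π x)) := fun x => rfl
  have hGι : ∀ a, G (ι a) = ι' (g₁ a) := fun a => by rw [hG]; simp [hπι, hl']
  have hGπ : ∀ x, π' (G x) = g₂ (π x) := fun x => by rw [hG]; simp [hπι', hs']
  have hinj : Function.Injective G := by
    rw [← LinearMap.ker_eq_bot, LinearMap.ker_eq_bot']
    intro x hx
    have h3 : π x = 0 := by
      have := hGπ x
      rw [hx, map_zero] at this
      exact g₂.injective (by rw [← this, map_zero])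
    have h4 : x ∈ LinearMap.range ι := by rw [hex]; exact h3
    obtain ⟨a, rfl⟩ := h4
    rw [hGι] at hx
    have h5 := hι' (hx.trans (map_zero ι').symm)
    rw [g₁.injective (h5.trans (map_zero g₁).symm), map_zero]
  have hsurj : Function.Surjective G := by
    intro y
    have h3 : y - G (s (g₂.symm (π' y))) ∈ LinearMap.range ι' := by
      rw [hex', LinearMap.mem_ker]; simp [hGπ, hs]
    obtain ⟨a, ha⟩ := h3
    refine ⟨ι (g₁.symm a) + s (g₂.symm (π' y)), ?_⟩
    rw [map_add, hGι, LinearEquiv.apply_symm_apply, ha, sub_add_cancel]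
  have hmem : ∀ a, ι a ∈ K ↔ ι' (g₁ a) ∈ K' := fun a => by
    rw [← Submodule.mem_comap (f := ι'), ← h₁, Submodule.mem_map_equiv]
    simp
  have hle : ∀ x ∈ K, G x ∈ K' := by
    intro x hx
    rw [hG]
    refine K'.add_mem ((hmem _).1 ?_) ?_
    · rw [hdec]; exact K.sub_mem hx (hsK x hx)
    · have : g₂ (π x) ∈ K'.map π' := by
        rw [← h₂]; exact Submodule.mem_map_of_mem (Submodule.mem_map_of_mem hx)
      obtain ⟨y, hy, hyx⟩ := this
      rw [← hyx]; exact hsK' y hy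
  refine ⟨LinearEquiv.ofBijective G ⟨hinj, hsurj⟩, hGι, hGπ, le_antisymm ?_ ?_⟩
  · rintro _ ⟨x, hx, rfl⟩; exact hle x hx
  · intro y hy
    obtain ⟨x, rfl⟩ := hsurj y
    refine ⟨x, ?_, rfl⟩
    have h3 : π x ∈ K.map π := by
      have h4 : g₂ (π x) ∈ (K.map π).map g₂.toLinearMap := by
        rw [h₂, ← hGπ]; exact Submodule.mem_map_of_mem hy
      rw [Submodule.mem_map_equiv] at h4
      simpa using h4
    obtain ⟨w, hw, hwx⟩ := h3
    have h5 : s (π x) ∈ K := by rw [← hwx]; exact hsK w hw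
    have h6 : ι (l (x - s (π x))) ∈ K := by
      rw [hmem, ← hGι, hdec, map_sub]
      exact K'.sub_mem hy (hle _ h5)
    rw [hdec] at h6
    simpa using K.add_mem h6 h5

theorem exists_equiv_of_ker_eq {f f' : E →ₗ[ℂ] C} (hf : Function.Surjective f)
    (hf' : Function.Surjective f') (h : LinearMap.ker f = LinearMap.ker f') :
    ∃ k : C ≃ₗ[ℂ] C, ∀ x, k (f x) = f' x := by
  refine ⟨(f.quotKerEquivOfSurjective hf).symm.trans ((Submodule.quotEquivOfEq _ _ h).trans
    (f'.quotKerEquivOfSurjective hf')), fun x => ?_⟩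
  have : (f.quotKerEquivOfSurjective hf).symm (f x) = Submodule.Quotient.mk x := by
    rw [LinearEquiv.symm_apply_eq]; rfl
  simp only [LinearEquiv.trans_apply, this]
  rfl

variable [FiniteDimensional ℂ E] [FiniteDimensional ℂ E']

theorem finrank_map_add_finrank_inf_ker (f : E →ₗ[ℂ] C) (S : Submodule ℂ E) :
    finrank ℂ (S.map f) + finrank ℂ (S ⊓ LinearMap.ker f : Submodule ℂ E) = finrank ℂ S := by
  have h := LinearMap.finrank_range_add_finrank_ker (f.domRestrict S)
  rw [LinearMap.range_domRestrict, LinearMap.ker_domRestrict] at h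
  rw [← h, ← Submodule.map_comap_subtype, Submodule.finrank_map_subtype_eq]

/-- Subspaces of equal dimension in spaces of equal dimension are matched by an isomorphism. -/
theorem exists_equiv_map_eq (K : Submodule ℂ E) (K' : Submodule ℂ E')
    (h : finrank ℂ E = finrank ℂ E') (hK : finrank ℂ K = finrank ℂ K') :
    ∃ g : E ≃ₗ[ℂ] E', K.map g.toLinearMap = K' := by
  have h₂ : finrank ℂ (E ⧸ K) = finrank ℂ (E' ⧸ K') := by
    have := K.finrank_quotient_add_finrank
    have := K'.finrank_quotient_add_finrank
    omega
  obtain ⟨g, -, -, hg⟩ := exists_lift_equiv K.injective_subtype K.mkQ_surjective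
    (by simp) K'.injective_subtype K'.mkQ_surjective (by simp)
    (LinearEquiv.ofFinrankEq _ _ hK) (LinearEquiv.ofFinrankEq _ _ h₂) K K'
    (by simp) (by simp)
  exact ⟨g, hg⟩

/-- An isomorphism of subspaces extends to an isomorphism of the ambient spaces that matches two
intermediate subspaces of equal dimension. -/
theorem exists_extend_equiv {ι : A →ₗ[ℂ] E} {ι' : A' →ₗ[ℂ] E'}
    (hι : Function.Injective ι) (hι' : Function.Injective ι') (g₁ : A ≃ₗ[ℂ] A')
    (K : Submodule ℂ E) (K' : Submodule ℂ E') (hK : LinearMap.range ι ≤ K)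
    (hK' : LinearMap.range ι' ≤ K') (h : finrank ℂ E = finrank ℂ E')
    (hKK : finrank ℂ K = finrank ℂ K') :
    ∃ g : E ≃ₗ[ℂ] E', (∀ a, g (ι a) = ι' (g₁ a)) ∧ K.map g.toLinearMap = K' := by
  have hr : finrank ℂ (LinearMap.range ι) = finrank ℂ (LinearMap.range ι') :=
    ((LinearEquiv.ofInjective ι hι).symm.trans
      (g₁.trans (LinearEquiv.ofInjective ι' hι'))).finrank_eq
  have hq : finrank ℂ (E ⧸ LinearMap.range ι) = finrank ℂ (E' ⧸ LinearMap.range ι') := by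
    have := (LinearMap.range ι).finrank_quotient_add_finrank
    have := (LinearMap.range ι').finrank_quotient_add_finrank
    omega
  have hKq : finrank ℂ (K.map (LinearMap.range ι).mkQ) =
      finrank ℂ (K'.map (LinearMap.range ι').mkQ) := by
    have h1 := finrank_map_add_finrank_inf_ker (LinearMap.range ι).mkQ K
    have h2 := finrank_map_add_finrank_inf_ker (LinearMap.range ι').mkQ K'
    rw [Submodule.ker_mkQ, inf_eq_right.2 hK] at h1
    rw [Submodule.ker_mkQ, inf_eq_right.2 hK'] at h2
    omega
  obtain ⟨g₂, hg₂⟩ := exists_equiv_map_eq _ _ hq hKq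
  have c1 : K.comap ι = ⊤ := eq_top_iff.2 fun a _ => hK ⟨a, rfl⟩
  have c2 : K'.comap ι' = ⊤ := eq_top_iff.2 fun a _ => hK' ⟨a, rfl⟩
  obtain ⟨g, hg, -, hgK⟩ := exists_lift_equiv hι (Submodule.mkQ_surjective _) (by simp)
    hι' (Submodule.mkQ_surjective _) (by simp) g₁ g₂ K K' (by rw [c1, c2]; simp) hg₂
  exact ⟨g, hg, hgK⟩

/-- Pairs `(K, t)` of a subspace and an endomorphism with `im t ⊆ K ⊆ ker t` are classified up to
isomorphism by `dim K` and `rank t`. -/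
theorem exists_equiv_conj {t : E →ₗ[ℂ] E} {t' : E' →ₗ[ℂ] E'} {K : Submodule ℂ E}
    {K' : Submodule ℂ E'} (h : finrank ℂ E = finrank ℂ E')
    (htK : LinearMap.range t ≤ K) (hKt : K ≤ LinearMap.ker t)
    (htK' : LinearMap.range t' ≤ K') (hKt' : K' ≤ LinearMap.ker t')
    (hr : finrank ℂ (LinearMap.range t) = finrank ℂ (LinearMap.range t'))
    (hK : finrank ℂ K = finrank ℂ K') :
    ∃ g : E ≃ₗ[ℂ] E', (∀ x, g (t x) = t' (g x)) ∧ K.map g.toLinearMap = K' := by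
  let θ := LinearEquiv.ofFinrankEq _ _ hr
  have hker : finrank ℂ (LinearMap.ker t) = finrank ℂ (LinearMap.ker t') := by
    have := t.finrank_range_add_finrank_ker
    have := t'.finrank_range_add_finrank_ker
    omega
  obtain ⟨g₁, hg₁, hgK⟩ := exists_extend_equiv
    (Submodule.inclusion_injective (htK.trans hKt))
    (Submodule.inclusion_injective (htK'.trans hKt')) θ
    (K.submoduleOf (LinearMap.ker t)) (K'.submoduleOf (LinearMap.ker t'))
    (by rintro _ ⟨a, rfl⟩; exact htK a.2) (by rintro _ ⟨a, rfl⟩; exact htK' a.2) hker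
    (by rw [(Submodule.submoduleOfEquivOfLe hKt).finrank_eq,
      (Submodule.submoduleOfEquivOfLe hKt').finrank_eq, hK])
  have m1 : K.map t.rangeRestrict = ⊥ := by
    rw [eq_bot_iff]; rintro _ ⟨x, hx, rfl⟩
    exact Subtype.ext (hKt hx)
  have m2 : K'.map t'.rangeRestrict = ⊥ := by
    rw [eq_bot_iff]; rintro _ ⟨x, hx, rfl⟩
    exact Subtype.ext (hKt' hx)
  obtain ⟨g, hgι, hgπ, hg⟩ := exists_lift_equiv (LinearMap.ker t).injective_subtype
    t.surjective_rangeRestrict (by simp)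
    (LinearMap.ker t').injective_subtype
    t'.surjective_rangeRestrict (by simp) g₁ θ K K' hgK
    (by rw [m1, m2]; simp)
  refine ⟨g, fun x => ?_, hg⟩
  have h1 := congrArg Subtype.val (hgπ x)
  have h2 := hgι (Submodule.inclusion (htK.trans hKt) (t.rangeRestrict x))
  have h3 := congrArg Subtype.val (hg₁ (t.rangeRestrict x))
  calc g (t x) = (g₁ (Submodule.inclusion (htK.trans hKt) (t.rangeRestrict x)) : E') := h2
    _ = (θ (t.rangeRestrict x) : E') := h3
    _ = t' (g x) := h1.symm

theorem exists_equiv_of_range_eq {f f' : E →ₗ[ℂ] C}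
    (h : LinearMap.range f = LinearMap.range f') :
    ∃ k : E ≃ₗ[ℂ] E, ∀ x, f' (k x) = f x := by
  have hker : finrank ℂ (LinearMap.ker f) = finrank ℂ (LinearMap.ker f') := by
    have h1 := f.finrank_range_add_finrank_ker
    have h2 := f'.finrank_range_add_finrank_ker
    rw [h] at h1
    omega
  obtain ⟨g, -, hg, -⟩ := exists_lift_equiv (LinearMap.ker f).injective_subtype
    f.surjective_rangeRestrict (by simp)
    (LinearMap.ker f').injective_subtype
    f'.surjective_rangeRestrict (by simp)
    (LinearEquiv.ofFinrankEq _ _ hker) (LinearEquiv.ofEq _ _ h) ⊥ ⊥ (by simp) (by simp)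
  exact ⟨g, fun x => congrArg Subtype.val (hg x)⟩

end LinearAlgebra

/-! ### Rational curves and the Zariski topology -/

section RationalCurves

open Polynomial in
/-- The algebra of functions on the complement of `F` in the affine line which are quotients of
polynomials with denominators that vanish nowhere on this complement. -/
def ratFun (F : Set ℂ) : Subalgebra ℂ ({s : ℂ // s ∉ F} → ℂ) where
  carrier := {h | ∃ P Q : ℂ[X], ∀ s, Q.eval s.1 ≠ 0 ∧ h s * Q.eval s.1 = P.eval s.1}
  mul_mem' := by
    rintro a b ⟨P, Q, h⟩ ⟨P', Q', h'⟩
    refine ⟨P * P', Q * Q', fun s => ⟨?_, ?_⟩⟩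
    · simp [(h s).1, (h' s).1]
    · simp only [Pi.mul_apply, eval_mul, ← (h s).2, ← (h' s).2]; ring
  add_mem' := by
    rintro a b ⟨P, Q, h⟩ ⟨P', Q', h'⟩
    refine ⟨P * Q' + P' * Q, Q * Q', fun s => ⟨?_, ?_⟩⟩
    · simp [(h s).1, (h' s).1]
    · simp only [Pi.add_apply, eval_mul, eval_add, ← (h s).2, ← (h' s).2]; ring
  algebraMap_mem' c := ⟨C c, 1, fun s => by simp⟩

variable {F : Set ℂ}

theorem const_mem_ratFun (c : ℂ) : (fun _ => c) ∈ ratFun F := (ratFun F).algebraMap_mem c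

theorem coe_mem_ratFun : (fun s => s.1) ∈ ratFun F := ⟨.X, 1, fun s => by simp⟩

theorem inv_mem_ratFun {h : {s : ℂ // s ∉ F} → ℂ} (hh : h ∈ ratFun F) (h0 : ∀ s, h s ≠ 0) :
    (fun s => (h s)⁻¹) ∈ ratFun F := by
  obtain ⟨P, Q, hPQ⟩ := hh
  refine ⟨Q, P, fun s => ⟨?_, ?_⟩⟩
  · rw [← (hPQ s).2]; exact mul_ne_zero (h0 s) (hPQ s).1
  · rw [← (hPQ s).2, inv_mul_cancel_left₀ (h0 s)]

theorem finite_zeros_of_mem_ratFun {h : {s : ℂ // s ∉ F} → ℂ} (hh : h ∈ ratFun F)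
    {s₀ : {s : ℂ // s ∉ F}} (h0 : h s₀ ≠ 0) : {s | h s = 0}.Finite := by
  obtain ⟨P, Q, hPQ⟩ := hh
  have hP : P ≠ 0 := by
    rintro rfl
    exact mul_ne_zero h0 (hPQ s₀).1 (by rw [(hPQ s₀).2, Polynomial.eval_zero])
  refine Set.Finite.of_finite_image (f := Subtype.val) ((P.rootSet_finite ℂ).subset ?_)
    Subtype.val_injective.injOn
  rintro _ ⟨s, hs, rfl⟩
  rw [Polynomial.mem_rootSet]
  refine ⟨hP, ?_⟩
  have := (hPQ s).2
  rw [show h s = 0 from hs, zero_mul] at this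
  simpa using this.symm

theorem det_mem_ratFun {n : Type*} [Fintype n] [DecidableEq n]
    {M : {s : ℂ // s ∉ F} → Matrix n n ℂ} (hM : ∀ i j, (fun s => M s i j) ∈ ratFun F) :
    (fun s => (M s).det) ∈ ratFun F := by
  have : (fun s => (M s).det) =
      ∑ σ : Equiv.Perm n, (fun _ => ((Equiv.Perm.sign σ : ℤ) : ℂ)) *
        ∏ i, (fun s => M s (σ i) i) := by
    ext s
    simp [Matrix.det_apply, Finset.sum_apply, Finset.prod_apply, Units.smul_def]
  rw [this]
  exact sum_mem fun σ _ => mul_mem (const_mem_ratFun _) (prod_mem fun i _ => hM _ _)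

variable {W W' W'' : Type*} [AddCommGroup W] [Module ℂ W] [AddCommGroup W'] [Module ℂ W']
  [AddCommGroup W''] [Module ℂ W'']

/-- A curve in `W`, defined on the complement of `F` in the affine line, is rational if its
coordinates are. -/
def IsRatCurve (γ : {s : ℂ // s ∉ F} → W) : Prop :=
  ∀ l : Dual ℂ W, (fun s => l (γ s)) ∈ ratFun F

theorem IsRatCurve.comp_mem_ratFun {γ : {s : ℂ // s ∉ F} → W} (hγ : IsRatCurve γ)
    {f : W → ℂ} (hf : f ∈ polyFun W) : (fun s => f (γ s)) ∈ ratFun F := by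
  induction hf using Algebra.adjoin_induction with
  | mem f hf => obtain ⟨l, rfl⟩ := hf; exact hγ l
  | algebraMap c => exact const_mem_ratFun c
  | add f g _ _ hf hg => exact add_mem hf hg
  | mul f g _ _ hf hg => exact mul_mem hf hg

/-- A rational curve is continuous for the cofinite topology on its domain. -/
theorem IsRatCurve.finite_compl {γ : {s : ℂ // s ∉ F} → W} (hγ : IsRatCurve γ) {O : Set W}
    (hO : @IsOpen _ (zariski W) O) {s₀ : {s : ℂ // s ∉ F}} (h0 : γ s₀ ∈ O) :
    {s | γ s ∉ O}.Finite := by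
  induction hO generalizing s₀ with
  | basic O hO =>
    obtain ⟨f, hf, rfl⟩ := hO
    refine (finite_zeros_of_mem_ratFun (hγ.comp_mem_ratFun hf) h0).subset fun s hs => ?_
    simpa using hs
  | univ => simp
  | inter O O' _ _ ih ih' =>
    refine ((ih h0.1).union (ih' h0.2)).subset fun s hs => ?_
    by_contra h
    simp only [Set.mem_union, Set.mem_ofPred_eq, not_or, not_not] at h
    exact hs h
  | sUnion 𝒮 _ ih =>
    obtain ⟨O, hO, h0⟩ := h0
    exact (ih O hO h0).subset fun s hs h => hs ⟨O, hO, h⟩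

theorem isRatCurve_line (x y : W) : IsRatCurve (F := F) fun s => (1 - s.1) • x + s.1 • y := by
  intro l
  simp only [map_add, map_smul, smul_eq_mul]
  exact add_mem (mul_mem (sub_mem (const_mem_ratFun 1) coe_mem_ratFun) (const_mem_ratFun _))
    (mul_mem coe_mem_ratFun (const_mem_ratFun _))

theorem IsRatCurve.prodMk {γ : {s : ℂ // s ∉ F} → W} {γ' : {s : ℂ // s ∉ F} → W'}
    (hγ : IsRatCurve γ) (hγ' : IsRatCurve γ') : IsRatCurve fun s => (γ s, γ' s) := by
  intro l
  have : (fun s => l (γ s, γ' s)) =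
      (fun s => (l ∘ₗ LinearMap.inl ℂ W W') (γ s)) +
        fun s => (l ∘ₗ LinearMap.inr ℂ W W') (γ' s) := by
    ext s; simp [← map_add]
  rw [this]
  exact add_mem (hγ _) (hγ' _)

theorem IsRatCurve.bilin [FiniteDimensional ℂ W] [FiniteDimensional ℂ W']
    {γ : {s : ℂ // s ∉ F} → W} {γ' : {s : ℂ // s ∉ F} → W'} (hγ : IsRatCurve γ)
    (hγ' : IsRatCurve γ') (B : W →ₗ[ℂ] W' →ₗ[ℂ] W'') : IsRatCurve fun s => B (γ s) (γ' s) := by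
  intro l
  let b := finBasis ℂ W
  let b' := finBasis ℂ W'
  have : (fun s => l (B (γ s) (γ' s))) = ∑ i, ∑ j,
      (fun s => b.coord i (γ s)) * (fun s => b'.coord j (γ' s)) * fun _ => l (B (b i) (b' j)) := by
    ext s
    conv_lhs => rw [← b.sum_repr (γ s), ← b'.sum_repr (γ' s)]
    simp only [map_sum, LinearMap.sum_apply, map_smul, LinearMap.smul_apply, smul_eq_mul,
      Finset.sum_apply, Pi.mul_apply, Basis.coord_apply, Finset.mul_sum, mul_assoc]
    rw [Finset.sum_comm]
    exact Finset.sum_congr rfl fun i _ => Finset.sum_congr rfl fun j _ => mul_left_comm _ _ _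
  rw [this]
  exact sum_mem fun i _ => sum_mem fun j _ =>
    mul_mem (mul_mem (hγ _) (hγ' _)) (const_mem_ratFun _)

theorem IsRatCurve.symm [FiniteDimensional ℂ W] {g : {s : ℂ // s ∉ F} → (W ≃ₗ[ℂ] W)}
    (hg : IsRatCurve fun s => (g s).toLinearMap) :
    IsRatCurve fun s => (g s).symm.toLinearMap := by
  intro l
  let b := finBasis ℂ W
  let M : {s : ℂ // s ∉ F} → Matrix _ _ ℂ := fun s => LinearMap.toMatrix b b (g s).toLinearMap
  have hM : ∀ i j, (fun s => M s i j) ∈ ratFun F := fun i j =>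
    hg ((LinearMap.proj j ∘ₗ LinearMap.proj i) ∘ₗ (LinearMap.toMatrix b b).toLinearMap)
  have hdet : ∀ s, (M s).det ≠ 0 := fun s => by
    have : IsUnit (LinearMap.det (g s).toLinearMap) := (g s).isUnit_det'
    rw [LinearMap.det_toMatrix]
    exact this.ne_zero
  have hinv : ∀ s, (g s).symm.toLinearMap = Matrix.toLin b b (M s)⁻¹ := fun s => by
    apply (LinearMap.toMatrix b b).injective
    rw [LinearMap.toMatrix_toLin]
    refine (Matrix.inv_eq_left_inv ?_).symm
    rw [← LinearMap.toMatrix_comp]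
    simp
  have hent : ∀ i j, (fun s => (M s)⁻¹ i j) ∈ ratFun F := fun i j => by
    have : (fun s => (M s)⁻¹ i j) = (fun s => (M s).det⁻¹) * fun s => (M s).adjugate i j := by
      ext s
      simp [Matrix.inv_def]
    rw [this]
    refine mul_mem (inv_mem_ratFun (det_mem_ratFun hM) hdet) ?_
    simp only [Matrix.adjugate_apply]
    refine det_mem_ratFun fun i' j' => ?_
    by_cases h : i' = j
    · subst h; simp only [Matrix.updateRow_self]; exact const_mem_ratFun _
    · simp only [Matrix.updateRow_ne h]; exact hM _ _
  have : (fun s => l (g s).symm.toLinearMap) = ∑ i, ∑ j, (fun s => (M s)⁻¹ i j) *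
      fun _ => l (Matrix.toLin b b (Matrix.single i j 1)) := by
    ext s
    rw [hinv]
    conv_lhs => rw [Matrix.matrix_eq_sum_single (M s)⁻¹]
    simp only [map_sum, Finset.sum_apply, Pi.mul_apply]
    refine Finset.sum_congr rfl fun i _ => Finset.sum_congr rfl fun j _ => ?_
    rw [← smul_eq_mul, ← map_smul, ← map_smul, Matrix.smul_single, smul_eq_mul, mul_one]
  rw [this]
  exact sum_mem fun i _ => sum_mem fun j _ => mul_mem (hent _ _) (const_mem_ratFun _)

theorem det_mem_polyFun {n : Type*} [Fintype n] [DecidableEq n] (M : W →ₗ[ℂ] Matrix n n ℂ) :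
    (fun w => (M w).det) ∈ polyFun W := by
  have : (fun w => (M w).det) =
      ∑ σ : Equiv.Perm n, (algebraMap ℂ (W → ℂ) ((Equiv.Perm.sign σ : ℤ) : ℂ)) *
        ∏ i, (fun w => M w (σ i) i) := by
    ext w
    simp [Matrix.det_apply, Finset.sum_apply, Finset.prod_apply, Units.smul_def]
  rw [this]
  exact sum_mem fun σ _ => mul_mem (Subalgebra.algebraMap_mem _ _) (prod_mem fun i _ =>
    Algebra.subset_adjoin ⟨LinearMap.proj i ∘ₗ LinearMap.proj (σ i) ∘ₗ M, rfl⟩)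

/-- The rank of a linear map that depends linearly on a parameter is lower semicontinuous. -/
theorem isOpen_le_finrank_range [FiniteDimensional ℂ W'] [FiniteDimensional ℂ W'']
    (T : W →ₗ[ℂ] W' →ₗ[ℂ] W'') (k : ℕ) :
    @IsOpen _ (zariski W) {w | k ≤ finrank ℂ (LinearMap.range (T w))} := by
  refine (@isOpen_iff_forall_mem_open _ (zariski W) _).2 fun w₀ hw₀ => ?_
  obtain ⟨b₀, hb₀⟩ := exists_linearIndependent_of_le_finrank hw₀
  let i : (Fin k → ℂ) →ₗ[ℂ] LinearMap.range (T w₀) := Fintype.linearCombination ℂ b₀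
  have hi : Function.Injective i := hb₀.fintypeLinearCombination_injective
  obtain ⟨r, hr⟩ := (T w₀).rangeRestrict.exists_rightInverse_of_surjective
    (LinearMap.range_rangeRestrict _)
  obtain ⟨b, hb⟩ := ((LinearMap.range (T w₀)).subtype ∘ₗ i).exists_leftInverse_of_injective
    (LinearMap.ker_eq_bot.2 (Subtype.val_injective.comp hi))
  let a := r ∘ₗ i
  have hab : b ∘ₗ T w₀ ∘ₗ a = LinearMap.id := by
    rw [← hb]
    ext1 x
    ext1
    simp only [LinearMap.comp_apply, a]
    congr 1
    exact congrArg Subtype.val (LinearMap.congr_fun hr (i _))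
  let M : W →ₗ[ℂ] Matrix (Fin k) (Fin k) ℂ :=
    LinearMap.toMatrix'.toLinearMap ∘ₗ LinearMap.compRight ℂ b ∘ₗ LinearMap.lcomp ℂ W'' a ∘ₗ T
  have hM : ∀ w, M w = LinearMap.toMatrix' (b ∘ₗ T w ∘ₗ a) := fun w => rfl
  -- The `k × k` minor `det (b ∘ T w ∘ a)` does not vanish at `w₀`.
  refine ⟨{w | (M w).det ≠ 0}, fun w hw => ?_,
    TopologicalSpace.isOpen_generateFrom_of_mem ⟨_, det_mem_polyFun M, rfl⟩, ?_⟩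
  · have h2 : LinearMap.range (b ∘ₗ T w ∘ₗ a) = ⊤ := LinearMap.range_eq_top.2
      (LinearEquiv.ofIsUnitDet (f := b ∘ₗ T w ∘ₗ a) (v := Pi.basisFun ℂ _)
        (v' := Pi.basisFun ℂ _)
        (by simpa [LinearMap.toMatrix_eq_toMatrix', ← hM] using hw)).surjective
    calc k = finrank ℂ (LinearMap.range (b ∘ₗ T w ∘ₗ a)) := by rw [h2]; simp
      _ ≤ finrank ℂ ((LinearMap.range (T w)).map b) := by
        refine Submodule.finrank_mono ?_
        rw [LinearMap.range_comp]
        exact Submodule.map_mono (LinearMap.range_comp_le_range _ _)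
      _ ≤ _ := Submodule.finrank_map_le _ _
  · rw [Set.mem_ofPred_eq, hM, hab]; simp

end RationalCurves

/-! ### Numerical invariants of data compatible with a flag -/

section Invariants

variable {D V : Type*} [AddCommGroup D] [Module ℂ D] [AddCommGroup V] [Module ℂ V]

theorem relDim_ker {W : Type*} [AddCommGroup W] [Module ℂ W] (f : V →ₗ[ℂ] W)
    (A : Submodule ℂ V) : relDim A (LinearMap.ker f) = finrank ℂ (A.map f) := by
  have h := (f.domRestrict A).quotKerEquivRange.finrank_eq
  rw [LinearMap.range_domRestrict, LinearMap.ker_domRestrict] at h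
  exact h

theorem mem_piS_iff {D₁ : Submodule ℂ D} {v₁ v₂ : ℕ} {z : ADHM D V} :
    z ∈ piS V D₁ v₁ v₂ ↔ LinearMap.range z.p = ⊤ ∧ D₁.map z.p ≤ D₁.comap z.q ∧
      finrank ℂ ((D₁.map z.p).map z.q) = v₁ ∧
      finrank ℂ (LinearMap.range (D₁.mkQ ∘ₗ z.q)) = v₂ := by
  have h : D₁.comap z.q = LinearMap.ker (D₁.mkQ ∘ₗ z.q) := by
    rw [LinearMap.ker_comp, Submodule.ker_mkQ]
  refine and_congr_right fun h1 => and_congr_right fun h2 => ?_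
  rw [relDim_ker, h, relDim_ker, show LinearMap.range z.p = ⊤ from h1, Submodule.map_top]

/-- `dim p(D₁)`. -/
noncomputable def ADHM.subDim (D₁ : Submodule ℂ D) (z : ADHM D V) : ℕ := finrank ℂ (D₁.map z.p)

/-- The rank of `q`, which is the rank of `q p` if `(p, q)` is stable. -/
noncomputable def ADHM.qRank (z : ADHM D V) : ℕ := finrank ℂ (LinearMap.range z.q)

/-- The action of `GL(D)`. -/
def ADHM.twist (g : D ≃ₗ[ℂ] D) (z : ADHM D V) : ADHM D V where
  p := z.p ∘ₗ g.symm.toLinearMap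
  q := g.toLinearMap ∘ₗ z.q
  pq := by
    ext x
    simpa using LinearMap.congr_fun z.pq x

theorem ADHM.p_q_apply (z : ADHM D V) (x : V) : z.p (z.q x) = 0 := LinearMap.congr_fun z.pq x

theorem ADHM.range_q_le (z : ADHM D V) : LinearMap.range z.q ≤ LinearMap.ker z.p := by
  rintro _ ⟨x, rfl⟩; exact z.p_q_apply x

theorem map_symm_eq_of_map_eq {g : D ≃ₗ[ℂ] D} {D₁ : Submodule ℂ D}
    (hg : D₁.map g.toLinearMap = D₁) : D₁.map g.symm.toLinearMap = D₁ := by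
  conv_lhs => rw [← hg]
  rw [← Submodule.map_comp]
  simp

theorem ADHM.map_twist_p {g : D ≃ₗ[ℂ] D} {D₁ : Submodule ℂ D}
    (hg : D₁.map g.toLinearMap = D₁) (z : ADHM D V) : D₁.map (z.twist g).p = D₁.map z.p := by
  rw [ADHM.twist, Submodule.map_comp, map_symm_eq_of_map_eq hg]

theorem ADHM.qRank_twist (g : D ≃ₗ[ℂ] D) (z : ADHM D V) : (z.twist g).qRank = z.qRank := by
  rw [ADHM.qRank, ADHM.twist, LinearMap.range_comp, LinearEquiv.finrank_map_eq]; rfl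

theorem twist_mem_piS {g : D ≃ₗ[ℂ] D} {D₁ : Submodule ℂ D} {v₁ v₂ : ℕ}
    (hg : D₁.map g.toLinearMap = D₁) {z : ADHM D V} (hz : z ∈ piS V D₁ v₁ v₂) :
    z.twist g ∈ piS V D₁ v₁ v₂ := by
  rw [mem_piS_iff] at hz ⊢
  rw [ADHM.map_twist_p hg]
  obtain ⟨h1, h2, h3, h4⟩ := hz
  refine ⟨?_, fun x hx => ?_, ?_, ?_⟩
  · rw [ADHM.twist, LinearMap.range_comp, LinearEquiv.range, Submodule.map_top, h1]
  · rw [Submodule.mem_comap]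
    change g (z.q x) ∈ D₁
    rw [← hg]
    exact Submodule.mem_map_of_mem (h2 hx)
  · rw [ADHM.twist, Submodule.map_comp, LinearEquiv.finrank_map_eq, h3]
  · have : D₁.mkQ ∘ₗ (z.twist g).q =
        (Submodule.Quotient.equiv D₁ D₁ g hg).toLinearMap ∘ₗ D₁.mkQ ∘ₗ z.q := by
      ext x; rfl
    rw [this, LinearMap.range_comp, LinearEquiv.finrank_map_eq, h4]

theorem mem_lambdaS_iff [FiniteDimensional ℂ V] {v₀ : ℕ} {z : ADHM D V} :
    z ∈ lambdaS D V v₀ ↔ LinearMap.range z.p = ⊤ ∧ z.qRank = v₀ := by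
  refine and_congr_right fun _ => ?_
  have := z.q.finrank_range_add_finrank_ker
  rw [ADHM.qRank]
  omega

variable [FiniteDimensional ℂ D]

/-- Quiver varieties are tensor product varieties for the flag `0 ⊆ 0 ⊆ D`. -/
theorem lambdaS_eq_piS_bot [FiniteDimensional ℂ V] (v₀ : ℕ) :
    lambdaS D V v₀ = piS V (⊥ : Submodule ℂ D) 0 v₀ := by
  ext z
  rw [mem_lambdaS_iff, mem_piS_iff]
  have h : finrank ℂ (LinearMap.range ((⊥ : Submodule ℂ D).mkQ ∘ₗ z.q)) = z.qRank := by
    have := finrank_map_add_finrank_inf_ker (⊥ : Submodule ℂ D).mkQ (LinearMap.range z.q)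
    rw [Submodule.ker_mkQ, inf_bot_eq, finrank_bot, add_zero] at this
    rw [LinearMap.range_comp, this, ADHM.qRank]
  simp [h]

theorem finrank_inf_ker_p {z : ADHM D V} (D₁ : Submodule ℂ D) :
    z.subDim D₁ + finrank ℂ (D₁ ⊓ LinearMap.ker z.p : Submodule ℂ D) = finrank ℂ D₁ :=
  finrank_map_add_finrank_inf_ker z.p D₁

theorem finrank_range_inf {D₁ : Submodule ℂ D} {v₁ v₂ : ℕ} {z : ADHM D V}
    (hz : z ∈ piS V D₁ v₁ v₂) :
    v₂ + finrank ℂ (LinearMap.range z.q ⊓ D₁ : Submodule ℂ D) = z.qRank := by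
  have := finrank_map_add_finrank_inf_ker D₁.mkQ (LinearMap.range z.q)
  rwa [Submodule.ker_mkQ, ← LinearMap.range_comp, (mem_piS_iff.1 hz).2.2.2] at this

theorem finrank_map_mkQ_ker_p {D₁ : Submodule ℂ D} {v₁ v₂ : ℕ} {z : ADHM D V}
    (hz : z ∈ piS V D₁ v₁ v₂) :
    finrank ℂ ((LinearMap.ker z.p).map D₁.mkQ) + finrank ℂ V =
      finrank ℂ (D ⧸ D₁) + z.subDim D₁ := by
  have h1 := finrank_map_add_finrank_inf_ker D₁.mkQ (LinearMap.ker z.p)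
  have h2 := finrank_inf_ker_p (z := z) D₁
  have h3 := z.p.finrank_range_add_finrank_ker
  have h4 := D₁.finrank_quotient_add_finrank
  rw [Submodule.ker_mkQ, inf_comm] at h1
  rw [(mem_piS_iff.1 hz).1, finrank_top] at h3
  omega

/-- The constraints on the invariants of a datum. -/
theorem invariants_le [FiniteDimensional ℂ V] {D₁ : Submodule ℂ D} {v₁ v₂ : ℕ} {z : ADHM D V}
    (hz : z ∈ piS V D₁ v₁ v₂) :
    v₁ ≤ z.subDim D₁ ∧ z.subDim D₁ + v₁ ≤ finrank ℂ D₁ ∧ z.subDim D₁ + v₂ ≤ finrank ℂ V ∧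
    finrank ℂ V + v₂ ≤ finrank ℂ (D ⧸ D₁) + z.subDim D₁ ∧
    z.qRank + z.subDim D₁ ≤ finrank ℂ V + v₁ ∧ z.qRank + z.subDim D₁ ≤ finrank ℂ D₁ + v₂ ∧
    v₁ + v₂ ≤ z.qRank := by
  have h1 := finrank_inf_ker_p (z := z) D₁
  have h2 := finrank_range_inf hz
  have h3 := finrank_map_mkQ_ker_p hz
  obtain ⟨hs, hD, e1, e2⟩ := mem_piS_iff.1 hz
  have h4 := finrank_map_add_finrank_inf_ker z.q (D₁.map z.p)
  have h5 := z.q.finrank_range_add_finrank_ker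
  have h6 := (D₁.mkQ ∘ₗ z.q).finrank_range_add_finrank_ker
  have l1 : finrank ℂ ((D₁.map z.p).map z.q) ≤
      finrank ℂ (LinearMap.range z.q ⊓ D₁ : Submodule ℂ D) := by
    refine Submodule.finrank_mono (le_inf LinearMap.map_le_range ?_)
    exact Submodule.map_le_iff_le_comap.2 hD
  have l2 : finrank ℂ (LinearMap.range z.q ⊓ D₁ : Submodule ℂ D) ≤
      finrank ℂ (D₁ ⊓ LinearMap.ker z.p : Submodule ℂ D) :=
    Submodule.finrank_mono (le_inf inf_le_right (inf_le_left.trans z.range_q_le))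
  have l3 : finrank ℂ (D₁.map z.p) ≤ finrank ℂ (LinearMap.ker (D₁.mkQ ∘ₗ z.q)) := by
    refine Submodule.finrank_mono ?_
    rwa [LinearMap.ker_comp, Submodule.ker_mkQ]
  have l4 : finrank ℂ (LinearMap.range (D₁.mkQ ∘ₗ z.q)) ≤
      finrank ℂ ((LinearMap.ker z.p).map D₁.mkQ) := by
    rw [LinearMap.range_comp]
    exact Submodule.finrank_mono (Submodule.map_mono z.range_q_le)
  have l5 : finrank ℂ (D₁.map z.p ⊓ LinearMap.ker z.q : Submodule ℂ V) ≤
      finrank ℂ (LinearMap.ker z.q) := Submodule.finrank_mono inf_le_right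
  have hu : finrank ℂ (D₁.map z.p) = z.subDim D₁ := rfl
  have hr : finrank ℂ (LinearMap.range z.q) = z.qRank := rfl
  rw [hu] at h4 l3
  rw [hr] at h5
  refine ⟨?_, ?_, ?_, ?_, ?_, ?_, ?_⟩ <;> omega

end Invariants

/-! ### Generic data -/

section Model

variable {D V : Type*} [AddCommGroup D] [Module ℂ D] [AddCommGroup V] [Module ℂ V]
  [FiniteDimensional ℂ D] [FiniteDimensional ℂ V]

/-- The datum with `D₁ = (X ⊕ X') ⊕ X ⊕ M ⊕ R₁`, complement `(Y ⊕ M ⊕ Y') ⊕ Y ⊕ R₂` of `D₁` and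
`V = (X ⊕ X') ⊕ Y ⊕ M ⊕ Y'`, for which `p` projects onto the first summands and `q` maps `X`, `M`
and `Y` identically onto their second copies in `D`. -/
theorem exists_mem_piS_of_decomposition (D₁ : Submodule ℂ D) (X X' M R₁ Y Y' R₂ : Type)
    [AddCommGroup X] [Module ℂ X] [FiniteDimensional ℂ X]
    [AddCommGroup X'] [Module ℂ X'] [FiniteDimensional ℂ X']
    [AddCommGroup M] [Module ℂ M] [FiniteDimensional ℂ M]
    [AddCommGroup R₁] [Module ℂ R₁] [FiniteDimensional ℂ R₁]
    [AddCommGroup Y] [Module ℂ Y] [FiniteDimensional ℂ Y]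
    [AddCommGroup Y'] [Module ℂ Y'] [FiniteDimensional ℂ Y']
    [AddCommGroup R₂] [Module ℂ R₂] [FiniteDimensional ℂ R₂]
    (h₁ : finrank ℂ D₁ = finrank ℂ ((X × X') × X × M × R₁))
    (h₂ : finrank ℂ (D ⧸ D₁) = finrank ℂ ((Y × M × Y') × Y × R₂))
    (hV : finrank ℂ V = finrank ℂ ((X × X') × Y × M × Y')) :
    ∃ z ∈ piS V D₁ (finrank ℂ X) (finrank ℂ Y), z.subDim D₁ = finrank ℂ (X × X') ∧
      z.qRank = finrank ℂ (X × M × Y) := by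
  have hD := D₁.finrank_quotient_add_finrank
  let ι := LinearMap.inl ℂ ((X × X') × X × M × R₁) ((Y × M × Y') × Y × R₂)
  have hι : finrank ℂ (LinearMap.range ι) = finrank ℂ ((X × X') × X × M × R₁) :=
    LinearMap.finrank_range_of_inj LinearMap.inl_injective
  obtain ⟨Φ, hΦ⟩ := exists_equiv_map_eq D₁ (LinearMap.range ι)
    (by rw [Module.finrank_prod]; omega) (by rw [hι, h₁])
  let Ψ : ((X × X') × Y × M × Y') ≃ₗ[ℂ] V := LinearEquiv.ofFinrankEq _ _ hV.symm
  let p : ((X × X') × X × M × R₁) × ((Y × M × Y') × Y × R₂) →ₗ[ℂ] (X × X') × Y × M × Y' :=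
    LinearMap.prodMap (LinearMap.fst ℂ _ _) (LinearMap.fst ℂ _ _)
  let j : X × M × Y →ₗ[ℂ] ((X × X') × X × M × R₁) × ((Y × M × Y') × Y × R₂) :=
    { toFun := fun a => ((0, a.1, a.2.1, 0), (0, a.2.2, 0))
      map_add' := fun a b => by simp
      map_smul' := fun c a => by simp }
  let k : (X × X') × Y × M × Y' →ₗ[ℂ] X × M × Y :=
    { toFun := fun a => (a.1.1, a.2.2.1, a.2.1)
      map_add' := fun a b => by simp
      map_smul' := fun c a => by simp }
  have hj : Function.Injective j := fun a b hab => by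
    simp only [j, LinearMap.coe_mk, AddHom.coe_mk, Prod.mk.injEq] at hab
    exact Prod.ext hab.1.2.1 (Prod.ext hab.1.2.2.1 hab.2.2.1)
  have hk : LinearMap.range k = ⊤ :=
    LinearMap.range_eq_top.2 fun a => ⟨((a.1, 0), (a.2.2, a.2.1, 0)), rfl⟩
  have hpa : ∀ a, p a = (a.1.1, a.2.1) := fun a => rfl
  have hka : ∀ a, k a = (a.1.1, a.2.2.1, a.2.1) := fun a => rfl
  have hja : ∀ a, j a = ((0, a.1, a.2.1, 0), (0, a.2.2, 0)) := fun a => rfl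
  let z : ADHM D V := ⟨Ψ.toLinearMap ∘ₗ p ∘ₗ Φ.toLinearMap,
    Φ.symm.toLinearMap ∘ₗ j ∘ₗ k ∘ₗ Ψ.symm.toLinearMap, by
      ext w
      simp [hpa, hja]⟩
  have hzp : ∀ w, z.p w = Ψ (p (Φ w)) := fun w => rfl
  have hzq : ∀ w, z.q w = Φ.symm (j (k (Ψ.symm w))) := fun w => rfl
  have hmem : ∀ w, w ∈ D₁ ↔ (Φ w).2 = 0 := fun w => by
    have h1 : w ∈ D₁ ↔ Φ w ∈ LinearMap.range ι := by
      rw [← hΦ, Submodule.mem_map_equiv]; simp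
    rw [h1]
    exact ⟨by rintro ⟨a, ha⟩; rw [← ha]; rfl, fun h => ⟨(Φ w).1, Prod.ext rfl h.symm⟩⟩
  have hmap : D₁.map z.p =
      (LinearMap.range (LinearMap.inl ℂ (X × X') (Y × M × Y'))).map Ψ.toLinearMap := by
    refine le_antisymm ?_ ?_
    · rintro _ ⟨w, hw, rfl⟩
      refine ⟨_, ⟨(Φ w).1.1, rfl⟩, ?_⟩
      rw [hzp, hpa, (hmem w).1 hw]
      rfl
    · rintro _ ⟨_, ⟨a, rfl⟩, rfl⟩
      refine ⟨Φ.symm ((a, 0), 0), (hmem _).2 (by simp), ?_⟩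
      rw [hzp, LinearEquiv.apply_symm_apply]
      rfl
  have hmapq : (D₁.map z.p).map z.q =
      (LinearMap.range (j ∘ₗ LinearMap.inl ℂ X (M × Y))).map Φ.symm.toLinearMap := by
    rw [hmap]
    refine le_antisymm ?_ ?_
    · rintro _ ⟨_, ⟨_, ⟨a, rfl⟩, rfl⟩, rfl⟩
      exact ⟨_, ⟨a.1, rfl⟩, by
        simp only [LinearEquiv.coe_coe, hzq, hka, LinearEquiv.symm_apply_apply]
        rfl⟩
    · rintro _ ⟨_, ⟨a, rfl⟩, rfl⟩
      exact ⟨_, ⟨_, ⟨(a, 0), rfl⟩, rfl⟩, by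
        simp only [LinearEquiv.coe_coe, hzq, hka, LinearEquiv.symm_apply_apply]
        rfl⟩
  have hker : LinearMap.ker (D₁.mkQ ∘ₗ z.q) =
      (LinearMap.ker (LinearMap.fst ℂ Y (M × Y') ∘ₗ LinearMap.snd ℂ (X × X') _)).map
        Ψ.toLinearMap := by
    ext w
    rw [Submodule.mem_map_equiv, LinearMap.mem_ker, LinearMap.comp_apply, Submodule.mkQ_apply,
      Submodule.Quotient.mk_eq_zero, hmem]
    simp [hzq, hja, hka, Prod.ext_iff]
  refine ⟨z, mem_piS_iff.2 ⟨?_, ?_, ?_, ?_⟩, ?_, ?_⟩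
  · rw [LinearMap.range_eq_top]
    intro w
    obtain ⟨a, rfl⟩ := Ψ.surjective w
    exact ⟨Φ.symm ((a.1, 0), (a.2, 0)), by rw [hzp, LinearEquiv.apply_symm_apply, hpa]⟩
  · rw [hmap]
    rintro _ ⟨_, ⟨a, rfl⟩, rfl⟩
    rw [Submodule.mem_comap, hmem]
    simp [hzq, hja, hka]
  · rw [hmapq, LinearEquiv.finrank_map_eq]
    exact LinearMap.finrank_range_of_inj (hj.comp LinearMap.inl_injective)
  · have h3 := (D₁.mkQ ∘ₗ z.q).finrank_range_add_finrank_ker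
    have h4 := (LinearMap.fst ℂ Y (M × Y') ∘ₗ
      LinearMap.snd ℂ (X × X') _).finrank_range_add_finrank_ker
    have h5 : LinearMap.range (LinearMap.fst ℂ Y (M × Y') ∘ₗ LinearMap.snd ℂ (X × X') _) = ⊤ :=
      LinearMap.range_eq_top.2 fun y => ⟨(0, y, 0), rfl⟩
    rw [h5, finrank_top, Ψ.finrank_eq] at h4
    rw [hker, LinearEquiv.finrank_map_eq] at h3
    omega
  · rw [ADHM.subDim, hmap, LinearEquiv.finrank_map_eq,
      LinearMap.finrank_range_of_inj LinearMap.inl_injective]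
  · rw [ADHM.qRank, LinearMap.range_comp, LinearEquiv.finrank_map_eq,
      LinearMap.range_comp, LinearMap.range_comp, LinearEquiv.range, Submodule.map_top, hk,
      Submodule.map_top, LinearMap.finrank_range_of_inj hj]

/-- Every value of `dim p(D₁)` allowed by `invariants_le` is attained, together with the largest
rank of `q` that it allows. -/
theorem exists_mem_piS (D₁ : Submodule ℂ D) {v₁ v₂ u₁ u₂ : ℕ}
    (hV : finrank ℂ V = u₁ + u₂) (h₁ : v₁ ≤ u₁) (h₁' : u₁ + v₁ ≤ finrank ℂ D₁) (h₂ : v₂ ≤ u₂)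
    (h₂' : u₂ + v₂ ≤ finrank ℂ (D ⧸ D₁)) :
    ∃ z ∈ piS V D₁ v₁ v₂, z.subDim D₁ = u₁ ∧
      z.qRank + u₁ = min (finrank ℂ V + v₁) (finrank ℂ D₁ + v₂) := by
  obtain ⟨m, hm⟩ : ∃ m, m = min (u₂ - v₂) (finrank ℂ D₁ - u₁ - v₁) := ⟨_, rfl⟩
  obtain ⟨z, hz, hu, hr⟩ := exists_mem_piS_of_decomposition (V := V) D₁ (Fin v₁ → ℂ)
    (Fin (u₁ - v₁) → ℂ) (Fin m → ℂ) (Fin (finrank ℂ D₁ - u₁ - v₁ - m) → ℂ) (Fin v₂ → ℂ)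
    (Fin (u₂ - v₂ - m) → ℂ) (Fin (finrank ℂ (D ⧸ D₁) - u₂ - v₂) → ℂ)
    (by simp only [Module.finrank_prod, Module.finrank_fin_fun]; omega)
    (by simp only [Module.finrank_prod, Module.finrank_fin_fun]; omega)
    (by simp only [Module.finrank_prod, Module.finrank_fin_fun]; omega)
  simp only [Module.finrank_prod, Module.finrank_fin_fun] at hz hu hr
  exact ⟨z, hz, by omega, by omega⟩

end Model

/-! ### Rational curves in orbit spaces -/

section Paths

variable {D V : Type*} [AddCommGroup D] [Module ℂ D] [AddCommGroup V] [Module ℂ V]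

/-- A rational curve in `A` joins `x` to a point in the `G_V`-orbit of `y`. -/
def Linked (A : Set (ADHM D V)) (x y : ADHM D V) : Prop :=
  ∃ (F : Set ℂ) (γ : {s : ℂ // s ∉ F} → ADHM D V), F.Finite ∧
    (IsRatCurve fun s => ((γ s).p, (γ s).q)) ∧ (∀ s, γ s ∈ A) ∧
    (∃ s, γ s = x) ∧ ∃ s, ∃ h : V ≃ₗ[ℂ] V, γ s = h • y

theorem OrbitSpace.mk_smul {S : Set (ADHM D V)} {z : ADHM D V} (hz : z ∈ S) {h : V ≃ₗ[ℂ] V}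
    (hz' : h • z ∈ S) : OrbitSpace.mk (h • z) hz' = OrbitSpace.mk z hz :=
  Quotient.sound ⟨h, rfl⟩

/-- The points of the orbit space of `S` that are represented in `A`. -/
def orbitsOf (S A : Set (ADHM D V)) : Set (OrbitSpace S) :=
  {x | ∃ (z : ADHM D V) (hz : z ∈ S), z ∈ A ∧ x = OrbitSpace.mk z hz}

/-- A set of orbits that are joined by rational curves is irreducible: two nonempty open subsets
pull back to two cofinite subsets of a curve. -/
theorem isPreirreducible_orbitsOf {S A : Set (ADHM D V)} (hAS : A ⊆ S)
    (h : ∀ x ∈ A, ∀ y ∈ A, Linked A x y) : IsPreirreducible (orbitsOf S A) := by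
  have key : ∀ U : Set (OrbitSpace S), IsOpen U →
      ∃ O, @IsOpen _ (zariski ((D →ₗ[ℂ] V) × (V →ₗ[ℂ] D))) O ∧
        ∀ z (hz : z ∈ S), OrbitSpace.mk z hz ∈ U ↔ (z.p, z.q) ∈ O := by
    intro U hU
    have h1 : IsOpen {z : S | OrbitSpace.mk z.1 z.2 ∈ U} :=
      (continuous_quotient_mk' (s := (MulAction.orbitRel (V ≃ₗ[ℂ] V) (ADHM D V)).comap
        (Subtype.val : S → ADHM D V))).isOpen_preimage U hU
    obtain ⟨O', hO', h2⟩ := isOpen_induced_iff.1 h1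
    obtain ⟨O, hO, rfl⟩ := (@isOpen_induced_iff _ _ (zariski _) _ _).1 hO'
    exact ⟨O, hO, fun z hz => (Set.ext_iff.1 h2 ⟨z, hz⟩).symm⟩
  rintro U U' hU hU' ⟨_, ⟨x, hxS, hx, rfl⟩, hxU⟩ ⟨_, ⟨y, hyS, hy, rfl⟩, hyU⟩
  obtain ⟨O, hO, hOU⟩ := key U hU
  obtain ⟨O', hO', hOU'⟩ := key U' hU'
  obtain ⟨F, γ, hF, hγ, hγA, ⟨s₀, hs₀⟩, s₁, g, hs₁⟩ := h x hx y hy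
  have e0 : ((γ s₀).p, (γ s₀).q) ∈ O := by rw [hs₀]; exact (hOU x hxS).1 hxU
  have e1 : ((γ s₁).p, (γ s₁).q) ∈ O' := by
    have hgy : g • y ∈ S := hs₁ ▸ hAS (hγA s₁)
    rw [hs₁]
    exact (hOU' _ hgy).1 (by rw [OrbitSpace.mk_smul hyS]; exact hyU)
  -- `ℂ` is infinite, so the two cofinite subsets of the curve meet.
  have hinf : Infinite {s : ℂ // s ∉ F} := (hF.infinite_compl).to_subtype
  have hfin := (hγ.finite_compl hO e0).union (hγ.finite_compl hO' e1)
  obtain ⟨s, hs⟩ := hfin.infinite_compl.nonempty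
  have hs' : ((γ s).p, (γ s).q) ∈ O ∧ ((γ s).p, (γ s).q) ∈ O' := by
    constructor <;> by_contra hcon
    · exact hs (Or.inl hcon)
    · exact hs (Or.inr hcon)
  have hsS := hAS (hγA s)
  exact ⟨OrbitSpace.mk (γ s) hsS, ⟨γ s, hsS, hγA s, rfl⟩, (hOU _ hsS).2 hs'.1,
    (hOU' _ hsS).2 hs'.2⟩

/-- A function on the orbit space given by a `G_V`-invariant function. -/
def OrbitSpace.lift {S : Set (ADHM D V)} (f : ADHM D V → ℕ)
    (hf : ∀ (h : V ≃ₗ[ℂ] V) z, f (h • z) = f z) : OrbitSpace S → ℕ :=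
  Quotient.lift (fun z : S => f z.1) (by
    rintro a b ⟨h, hab⟩
    have : h • b.1 = a.1 := hab
    change f a.1 = f b.1
    rw [← this, hf])

theorem OrbitSpace.isOpen_le_lift {S : Set (ADHM D V)} (f : ADHM D V → ℕ)
    (hf : ∀ (h : V ≃ₗ[ℂ] V) z, f (h • z) = f z) (k : ℕ) (ho : IsOpen {z | k ≤ f z}) :
    IsOpen {x : OrbitSpace S | k ≤ OrbitSpace.lift f hf x} := by
  refine isOpen_coinduced.2 ?_
  exact continuous_subtype_val.isOpen_preimage _ ho

theorem ADHM.smul_p (h : V ≃ₗ[ℂ] V) (z : ADHM D V) : (h • z).p = h.toLinearMap ∘ₗ z.p := rfl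

theorem ADHM.smul_q (h : V ≃ₗ[ℂ] V) (z : ADHM D V) : (h • z).q = z.q ∘ₗ h.symm.toLinearMap := rfl

theorem ADHM.subDim_smul (D₁ : Submodule ℂ D) (h : V ≃ₗ[ℂ] V) (z : ADHM D V) :
    (h • z).subDim D₁ = z.subDim D₁ := by
  rw [ADHM.subDim, ADHM.smul_p, Submodule.map_comp, LinearEquiv.finrank_map_eq]; rfl

theorem ADHM.qRank_smul (h : V ≃ₗ[ℂ] V) (z : ADHM D V) : (h • z).qRank = z.qRank := by
  rw [ADHM.qRank, ADHM.smul_q, LinearMap.range_comp, LinearEquiv.range, Submodule.map_top]; rfl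

variable [FiniteDimensional ℂ D] [FiniteDimensional ℂ V]

theorem ADHM.isOpen_le_subDim (D₁ : Submodule ℂ D) (k : ℕ) :
    IsOpen {z : ADHM D V | k ≤ z.subDim D₁} := by
  refine (@isOpen_induced_iff _ _ (zariski _) _ _).2 ⟨_, isOpen_le_finrank_range
    (LinearMap.lcomp ℂ V D₁.subtype ∘ₗ LinearMap.fst ℂ _ (V →ₗ[ℂ] D)) k, ?_⟩
  ext z
  have : LinearMap.range (z.p ∘ₗ D₁.subtype) = D₁.map z.p := by
    rw [LinearMap.range_comp, Submodule.range_subtype]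
  change k ≤ finrank ℂ (LinearMap.range (z.p ∘ₗ D₁.subtype)) ↔ k ≤ finrank ℂ (D₁.map z.p)
  rw [this]

theorem ADHM.isOpen_le_qRank (k : ℕ) : IsOpen {z : ADHM D V | k ≤ z.qRank} :=
  (@isOpen_induced_iff _ _ (zariski _) _ _).2 ⟨_, isOpen_le_finrank_range
    (LinearMap.snd ℂ (D →ₗ[ℂ] V) (V →ₗ[ℂ] D)) k, rfl⟩

/-- A line of linear maps through a surjection is surjective outside a finite set. -/
theorem finite_not_surjective_line {W W' : Type*} [AddCommGroup W] [Module ℂ W]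
    [AddCommGroup W'] [Module ℂ W'] [FiniteDimensional ℂ W] [FiniteDimensional ℂ W']
    (x y : W →ₗ[ℂ] W') (hx : Function.Surjective x) :
    {s : ℂ | ¬ Function.Surjective ((1 - s) • x + s • y)}.Finite := by
  have h1 : ∀ f : W →ₗ[ℂ] W', Function.Surjective f ↔
      finrank ℂ W' ≤ finrank ℂ (LinearMap.range f) := fun f => by
    rw [← LinearMap.range_eq_top]
    exact ⟨fun h => by rw [h, finrank_top], fun h => Submodule.eq_top_of_finrank_eq
      (le_antisymm (Submodule.finrank_le _) h)⟩
  have h2 := (isRatCurve_line (F := ∅) x y).finite_compl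
    (isOpen_le_finrank_range (LinearMap.id (R := ℂ) (M := W →ₗ[ℂ] W')) (finrank ℂ W'))
    (s₀ := ⟨0, by simp⟩) (by simpa using (h1 x).1 hx)
  refine (h2.image Subtype.val).subset fun s hs => ⟨⟨s, by simp⟩, ?_, rfl⟩
  simpa [h1] using hs

/-- A line of data `w`, moved along a line from `1` to `g` in the stabilizer of `D₁` in `GL(D)`,
is a rational curve from `w 0` to `g • w 1`. -/
theorem linked_of_line {D₁ : Submodule ℂ D} {A : Set (ADHM D V)} {x y : ADHM D V}
    (hA : ∀ g : D ≃ₗ[ℂ] D, D₁.map g.toLinearMap = D₁ → ∀ z ∈ A, z.twist g ∈ A)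
    (w : ℂ → ADHM D V) (p p' : D →ₗ[ℂ] V) (q q' : V →ₗ[ℂ] D)
    (hp : ∀ s, (w s).p = (1 - s) • p + s • p') (hq : ∀ s, (w s).q = (1 - s) • q + s • q')
    (hw : {s | w s ∉ A}.Finite) (g : D ≃ₗ[ℂ] D) (hg : D₁.map g.toLinearMap = D₁)
    (h0 : w 0 = x) (hx : x ∈ A) (h1 : ∃ h : V ≃ₗ[ℂ] V, (w 1).twist g = h • y)
    (hA1 : w 1 ∈ A) : Linked A x y := by
  let l : ℂ → D →ₗ[ℂ] D := fun s => (1 - s) • LinearMap.id + s • g.toLinearMap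
  let F : Set ℂ := {s | w s ∉ A} ∪ {s | ¬ Function.Surjective (l s)}
  have hl0 : l 0 = LinearMap.id := by simp [l]
  have hl1 : l 1 = g.toLinearMap := by simp [l]
  have hF : F.Finite := hw.union (finite_not_surjective_line _ _ Function.surjective_id)
  have hFA : ∀ s ∉ F, w s ∈ A := fun s hs => by
    by_contra hcon; exact hs (Or.inl hcon)
  have hFl : ∀ s : {s : ℂ // s ∉ F}, ∃ e : D ≃ₗ[ℂ] D, e.toLinearMap = l s := fun s => by
    have hsurj : Function.Surjective (l s) := by
      by_contra hcon; exact s.2 (Or.inr hcon)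
    exact ⟨LinearEquiv.ofBijective (l s) ⟨LinearMap.injective_iff_surjective.2 hsurj, hsurj⟩, rfl⟩
  choose e he using hFl
  have heD : ∀ s, D₁.map (e s).toLinearMap = D₁ := fun s => by
    refine Submodule.eq_of_le_of_finrank_eq ?_ (LinearEquiv.finrank_map_eq _ _)
    rw [he]
    rintro _ ⟨a, ha, rfl⟩
    refine D₁.add_mem (D₁.smul_mem _ ha) (D₁.smul_mem _ ?_)
    exact hg.le (Submodule.mem_map_of_mem ha)
  have her : IsRatCurve fun s => (e s).toLinearMap := by
    simp only [he]
    exact isRatCurve_line _ _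
  have n0 : (0 : ℂ) ∉ F := by
    rintro (h | h)
    · exact h (h0 ▸ hx)
    · exact h (by rw [hl0]; exact Function.surjective_id)
  have n1 : (1 : ℂ) ∉ F := by
    rintro (h | h)
    · exact h hA1
    · exact h (by rw [hl1]; exact g.surjective)
  have e0 : e ⟨0, n0⟩ = LinearEquiv.refl ℂ D :=
    LinearEquiv.toLinearMap_injective ((he _).trans hl0)
  have e1 : e ⟨1, n1⟩ = g := LinearEquiv.toLinearMap_injective ((he _).trans hl1)
  refine ⟨F, fun s => (w s).twist (e s), hF, ?_, fun s => hA _ (heD s) _ (hFA s s.2),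
    ⟨⟨0, n0⟩, ?_⟩, ⟨1, n1⟩, ?_⟩
  · refine IsRatCurve.prodMk ?_ ?_
    · have : IsRatCurve (F := F) fun s => (w s).p := by
        simp only [hp]; exact isRatCurve_line _ _
      exact this.bilin her.symm (LinearMap.llcomp ℂ D D V)
    · have : IsRatCurve (F := F) fun s => (w s).q := by
        simp only [hq]; exact isRatCurve_line _ _
      exact her.bilin this (LinearMap.llcomp ℂ V D D)
  · simp only [e0, h0]; rfl
  · simpa only [e1] using h1

end Paths

/-! ### Irreducibility of the strata -/

section Strata

/-- The classification `exists_equiv_conj` for the two diagonal blocks of endomorphisms that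
preserve `D₁`. -/
theorem exists_equiv_conj_diagonal {D : Type*} [AddCommGroup D] [Module ℂ D]
    [FiniteDimensional ℂ D] {D₁ : Submodule ℂ D} {t t' : D →ₗ[ℂ] D} {K K' : Submodule ℂ D}
    (hD : D₁ ≤ D₁.comap t) (hD' : D₁ ≤ D₁.comap t')
    (htK : LinearMap.range t ≤ K) (hKt : K ≤ LinearMap.ker t)
    (htK' : LinearMap.range t' ≤ K') (hKt' : K' ≤ LinearMap.ker t')
    (h₁ : finrank ℂ (D₁.map t) = finrank ℂ (D₁.map t'))
    (h₂ : finrank ℂ (LinearMap.range (D₁.mkQ ∘ₗ t)) =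
      finrank ℂ (LinearMap.range (D₁.mkQ ∘ₗ t')))
    (h₃ : finrank ℂ (D₁ ⊓ K : Submodule ℂ D) = finrank ℂ (D₁ ⊓ K' : Submodule ℂ D))
    (h₄ : finrank ℂ (K.map D₁.mkQ) = finrank ℂ (K'.map D₁.mkQ)) :
    ∃ g : D ≃ₗ[ℂ] D, D₁.map g.toLinearMap = D₁ ∧ K.map g.toLinearMap = K' ∧
      (∀ x ∈ D₁, g (t x) = t' (g x)) ∧ ∀ x, D₁.mkQ (g (t x)) = D₁.mkQ (t' (g x)) := by
  have rk₁ : ∀ {t : D →ₗ[ℂ] D} (hD : D₁ ≤ D₁.comap t),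
      finrank ℂ (LinearMap.range (t.restrict hD)) = finrank ℂ (D₁.map t) := fun {t} hD => by
    rw [← Submodule.finrank_map_subtype_eq, ← LinearMap.range_comp]
    have : D₁.subtype ∘ₗ t.restrict hD = t ∘ₗ D₁.subtype := by ext; rfl
    rw [this, LinearMap.range_comp, Submodule.range_subtype]
  have rk₂ : ∀ {t : D →ₗ[ℂ] D} (hD : D₁ ≤ D₁.comap t),
      LinearMap.range (D₁.mapQ D₁ t hD) = LinearMap.range (D₁.mkQ ∘ₗ t) := fun {t} hD => by
    rw [← Submodule.mapQ_mkQ D₁ D₁ t (h := hD),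
      LinearMap.range_comp_of_range_eq_top _ D₁.range_mkQ]
  have rK : ∀ K : Submodule ℂ D,
      finrank ℂ (K.comap D₁.subtype) = finrank ℂ (D₁ ⊓ K : Submodule ℂ D) := fun K => by
    rw [← Submodule.finrank_map_subtype_eq, Submodule.map_comap_subtype]
  have q₁ : ∀ {t : D →ₗ[ℂ] D} {K : Submodule ℂ D} (hD : D₁ ≤ D₁.comap t)
      (_ : LinearMap.range t ≤ K) (_ : K ≤ LinearMap.ker t),
      LinearMap.range (t.restrict hD) ≤ K.comap D₁.subtype ∧
        K.comap D₁.subtype ≤ LinearMap.ker (t.restrict hD) ∧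
        LinearMap.range (D₁.mapQ D₁ t hD) ≤ K.map D₁.mkQ ∧
        K.map D₁.mkQ ≤ LinearMap.ker (D₁.mapQ D₁ t hD) := by
    intro t K hD h h'
    refine ⟨?_, fun x hx => Subtype.ext (h' hx), ?_, ?_⟩
    · rintro _ ⟨x, rfl⟩; exact h ⟨x, rfl⟩
    · rw [rk₂ hD, LinearMap.range_comp]; exact Submodule.map_mono h
    · rintro _ ⟨x, hx, rfl⟩
      have : t x = 0 := h' hx
      simp [this]
  obtain ⟨a1, a2, a3, a4⟩ := q₁ hD htK hKt
  obtain ⟨b1, b2, b3, b4⟩ := q₁ hD' htK' hKt'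
  obtain ⟨g₁, hg₁, hgK₁⟩ := exists_equiv_conj rfl a1 a2 b1 b2 (by rw [rk₁, rk₁, h₁])
    (by rw [rK, rK, h₃])
  obtain ⟨g₂, hg₂, hgK₂⟩ := exists_equiv_conj rfl a3 a4 b3 b4 (by rw [rk₂, rk₂, h₂]) h₄
  obtain ⟨g, hgι, hgπ, hg⟩ := exists_lift_equiv D₁.injective_subtype D₁.mkQ_surjective (by simp)
    D₁.injective_subtype D₁.mkQ_surjective (by simp) g₁ g₂ K K' hgK₁ hgK₂
  refine ⟨g, ?_, hg, fun x hx => ?_, fun x => ?_⟩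
  · refine Submodule.eq_of_le_of_finrank_eq ?_ (LinearEquiv.finrank_map_eq _ _)
    rintro _ ⟨x, hx, rfl⟩
    have := hgι ⟨x, hx⟩
    simp only [Submodule.subtype_apply] at this
    rw [LinearEquiv.coe_coe, this]
    exact (g₁ _).2
  · have h1 := congrArg Subtype.val (hg₁ ⟨x, hx⟩)
    have h2 := hgι (t.restrict hD ⟨x, hx⟩)
    have h3 := hgι ⟨x, hx⟩
    simp only [Submodule.subtype_apply] at h2 h3
    rw [h3]
    exact h2.trans h1
  · rw [hgπ]
    have h1 := hg₂ (D₁.mkQ x)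
    rw [← hgπ] at h1
    exact h1

variable {D V : Type*} [AddCommGroup D] [Module ℂ D] [AddCommGroup V] [Module ℂ V]
  {D₁ : Submodule ℂ D} {v₁ v₂ : ℕ}

theorem ADHM.comp_range_le (z : ADHM D V) :
    LinearMap.range (z.q ∘ₗ z.p) ≤ LinearMap.range z.q ∧
      LinearMap.ker z.p ≤ LinearMap.ker (z.q ∘ₗ z.p) :=
  ⟨LinearMap.range_comp_le_range _ _, LinearMap.ker_le_ker_comp _ _⟩

theorem finrank_diagonal_eq {z : ADHM D V} (hz : z ∈ piS V D₁ v₁ v₂) :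
    D₁ ≤ D₁.comap (z.q ∘ₗ z.p) ∧ finrank ℂ (D₁.map (z.q ∘ₗ z.p)) = v₁ ∧
      finrank ℂ (LinearMap.range (D₁.mkQ ∘ₗ z.q ∘ₗ z.p)) = v₂ := by
  obtain ⟨h1, h2, h3, h4⟩ := mem_piS_iff.1 hz
  refine ⟨fun x hx => h2 (Submodule.mem_map_of_mem hx), by rw [Submodule.map_comp, h3], ?_⟩
  rw [← LinearMap.comp_assoc, LinearMap.range_comp_of_range_eq_top _ h1, h4]

theorem twist_smul_eq_of {w z' : ADHM D V} (g : D ≃ₗ[ℂ] D) (h : V ≃ₗ[ℂ] V)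
    (hp : ∀ x, h (w.p x) = z'.p (g x)) (hq : ∀ x, g (w.q x) = z'.q (h x)) :
    w.twist g = h.symm • z' := by
  ext x
  · have := hp (g.symm x)
    rw [LinearEquiv.apply_symm_apply] at this
    change w.p (g.symm x) = h.symm (z'.p x)
    rw [← this, LinearEquiv.symm_apply_apply]
  · exact hq x

variable [FiniteDimensional ℂ D] [FiniteDimensional ℂ V]

/-- The locus of fixed `dim p(D₁)` is rationally connected modulo `G_V`: an element of the
stabilizer of `D₁` matches the maps `p` and the diagonal blocks of `q p`, and the remaining block
of `q` moves along a line. -/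
theorem linked_of_subDim_eq (k : ℕ) {x y : ADHM D V}
    (hx : x ∈ {z | z ∈ piS V D₁ v₁ v₂ ∧ z.subDim D₁ = k})
    (hy : y ∈ {z | z ∈ piS V D₁ v₁ v₂ ∧ z.subDim D₁ = k}) :
    Linked {z | z ∈ piS V D₁ v₁ v₂ ∧ z.subDim D₁ = k} x y := by
  obtain ⟨hx, hxk⟩ := hx
  obtain ⟨hy, hyk⟩ := hy
  obtain ⟨a1, a2, a3⟩ := finrank_diagonal_eq hx
  obtain ⟨b1, b2, b3⟩ := finrank_diagonal_eq hy
  have x3 := finrank_map_mkQ_ker_p hx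
  have y3 := finrank_map_mkQ_ker_p hy
  have x4 := finrank_inf_ker_p (z := x) D₁
  have y4 := finrank_inf_ker_p (z := y) D₁
  obtain ⟨xs, xD, x1, x2⟩ := mem_piS_iff.1 hx
  obtain ⟨ys, yD, y1, y2⟩ := mem_piS_iff.1 hy
  -- `g` maps `ker x.p` to `ker y.p`, so `y.p g = h x.p`; then `q' = g⁻¹ y.q h` differs from `x.q`
  -- only in the block `V / p(D₁) → D₁`.
  obtain ⟨g, hgD, hgK, hg₁, hg₂⟩ := exists_equiv_conj_diagonal (K := LinearMap.ker x.p)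
    (K' := LinearMap.ker y.p) a1 b1 (x.comp_range_le.1.trans x.range_q_le) x.comp_range_le.2
    (y.comp_range_le.1.trans y.range_q_le) y.comp_range_le.2 (a2.trans b2.symm)
    (a3.trans b3.symm) (by omega) (by omega)
  obtain ⟨h, hh⟩ := exists_equiv_of_ker_eq (f := x.p) (f' := y.p ∘ₗ g.toLinearMap)
    (LinearMap.range_eq_top.1 xs) ((LinearMap.range_eq_top.1 ys).comp g.surjective) (by
      rw [LinearMap.ker_comp, ← hgK, Submodule.comap_map_eq_of_injective g.injective])
  have hh' : ∀ a, h (x.p a) = y.p (g a) := hh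
  let q' : V →ₗ[ℂ] D := g.symm.toLinearMap ∘ₗ y.q ∘ₗ h.toLinearMap
  have hgq : ∀ a, g (q' a) = y.q (h a) := fun a => g.apply_symm_apply _
  have hpq' : ∀ a, x.p (q' a) = 0 := fun a => h.injective (by
    rw [hh', hgq, y.p_q_apply, map_zero])
  have hq₁ : ∀ a ∈ D₁.map x.p, q' a = x.q a := by
    rintro _ ⟨a, ha, rfl⟩
    apply g.injective
    rw [hgq, hh']
    exact (hg₁ a ha).symm
  have hq₂ : ∀ a, D₁.mkQ (q' a) = D₁.mkQ (x.q a) := fun a => by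
    obtain ⟨b, rfl⟩ := LinearMap.range_eq_top.1 xs a
    have h1 := hg₂ b
    have h2 : g (x.q (x.p b)) - g (q' (x.p b)) ∈ D₁ := by
      rw [hgq, hh', ← Submodule.Quotient.eq]; exact h1
    rw [← map_sub] at h2
    have h3 : x.q (x.p b) - q' (x.p b) ∈ D₁ := by
      rw [← hgD, Submodule.mem_map] at h2
      obtain ⟨c, hc, hc'⟩ := h2
      rwa [← g.injective hc']
    exact ((Submodule.Quotient.eq _).2 h3).symm
  let w : ℂ → ADHM D V := fun s => ⟨x.p, (1 - s) • x.q + s • q', by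
    ext a; simp [x.p_q_apply, hpq']⟩
  have hwA : ∀ s, w s ∈ {z | z ∈ piS V D₁ v₁ v₂ ∧ z.subDim D₁ = k} := fun s => by
    have e1 : ∀ a ∈ D₁.map x.p, (w s).q a = x.q a := fun a ha => by
      change (1 - s) • x.q a + s • q' a = x.q a
      rw [hq₁ a ha, ← add_smul, sub_add_cancel, one_smul]
    have e2 : D₁.mkQ ∘ₗ (w s).q = D₁.mkQ ∘ₗ x.q := by
      refine LinearMap.ext fun a => ?_
      change D₁.mkQ ((1 - s) • x.q a + s • q' a) = D₁.mkQ (x.q a)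
      rw [map_add, map_smul, map_smul, hq₂, ← add_smul, sub_add_cancel, one_smul]
    refine ⟨mem_piS_iff.2 ⟨xs, fun a ha => ?_, ?_, ?_⟩, hxk⟩
    · rw [Submodule.mem_comap, e1 a ha]; exact xD ha
    · have e3 : (D₁.map x.p).map (w s).q = (D₁.map x.p).map x.q :=
        SetLike.coe_injective (Set.image_congr e1)
      exact (congrArg (fun S : Submodule ℂ D => finrank ℂ S) e3).trans x1
    · rw [e2, x2]
  refine linked_of_line (fun g hg z hz => ⟨twist_mem_piS hg hz.1, ?_⟩) w x.p x.p x.q q' ?_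
    (fun s => rfl) ?_ g hgD ?_ ⟨hx, hxk⟩ ⟨h.symm, ?_⟩ (hwA 1)
  · rw [ADHM.subDim, ADHM.map_twist_p hg]; exact hz.2
  · intro s
    rw [← add_smul, sub_add_cancel, one_smul]
  · simp only [hwA, not_true_eq_false, Set.ofPred_false, Set.finite_empty]
  · ext a <;> simp [w]
  · refine twist_smul_eq_of g h hh' fun a => ?_
    rw [← hgq]
    simp [w]

/-- The locus of fixed rank of `q` is rationally connected modulo `G_V`: an element of the
stabilizer of `D₁` matches the maps `q` and the restrictions of `q p` to `D₁`, and the rest of `p`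
moves along a line. -/
theorem linked_of_qRank_eq (k : ℕ) {x y : ADHM D V}
    (hx : x ∈ {z | z ∈ piS V D₁ v₁ v₂ ∧ z.qRank = k})
    (hy : y ∈ {z | z ∈ piS V D₁ v₁ v₂ ∧ z.qRank = k}) :
    Linked {z | z ∈ piS V D₁ v₁ v₂ ∧ z.qRank = k} x y := by
  obtain ⟨hx, hxk⟩ := hx
  obtain ⟨hy, hyk⟩ := hy
  obtain ⟨a1, a2, a3⟩ := finrank_diagonal_eq hx
  obtain ⟨b1, b2, b3⟩ := finrank_diagonal_eq hy
  have x3 := finrank_range_inf hx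
  have y3 := finrank_range_inf hy
  obtain ⟨xs, xD, x1, x2⟩ := mem_piS_iff.1 hx
  obtain ⟨ys, yD, y1, y2⟩ := mem_piS_iff.1 hy
  rw [inf_comm] at x3 y3
  -- `g` maps `im x.q` to `im y.q`, so `g x.q = y.q h`; then `p' = h⁻¹ y.p g` satisfies
  -- `x.q p' = x.q x.p` on `D₁`.
  obtain ⟨g, hgD, hgK, hg₁, -⟩ := exists_equiv_conj_diagonal (K := LinearMap.range x.q)
    (K' := LinearMap.range y.q) a1 b1 x.comp_range_le.1 (x.range_q_le.trans x.comp_range_le.2)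
    y.comp_range_le.1 (y.range_q_le.trans y.comp_range_le.2) (a2.trans b2.symm)
    (a3.trans b3.symm) (by omega) (by rw [← LinearMap.range_comp, ← LinearMap.range_comp, x2, y2])
  obtain ⟨h, hh⟩ := exists_equiv_of_range_eq (f := g.toLinearMap ∘ₗ x.q) (f' := y.q) (by
    rw [LinearMap.range_comp, hgK])
  have hh' : ∀ a, g (x.q a) = y.q (h a) := fun a => (hh a).symm
  let p' : D →ₗ[ℂ] V := h.symm.toLinearMap ∘ₗ y.p ∘ₗ g.toLinearMap
  have hhp : ∀ a, h (p' a) = y.p (g a) := fun a => h.apply_symm_apply _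
  have hpq' : ∀ a, p' (x.q a) = 0 := fun a => h.injective (by
    rw [hhp, hh', y.p_q_apply, map_zero])
  have hqp : ∀ a ∈ D₁, x.q (p' a) = x.q (x.p a) := fun a ha => g.injective (by
    rw [hh', hhp]; exact (hg₁ a ha).symm)
  let w : ℂ → ADHM D V := fun s => ⟨(1 - s) • x.p + s • p', x.q, by
    ext a; simp [x.p_q_apply, hpq']⟩
  have hwA : ∀ s, Function.Surjective ((1 - s) • x.p + s • p' : D →ₗ[ℂ] V) →
      w s ∈ {z | z ∈ piS V D₁ v₁ v₂ ∧ z.qRank = k} := fun s hs => by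
    have e1 : ∀ a ∈ D₁, (x.q ∘ₗ (w s).p) a = (x.q ∘ₗ x.p) a := fun a ha => by
      change x.q ((1 - s) • x.p a + s • p' a) = x.q (x.p a)
      rw [map_add, map_smul, map_smul, hqp a ha, ← add_smul, sub_add_cancel, one_smul]
    refine ⟨mem_piS_iff.2 ⟨LinearMap.range_eq_top.2 hs, ?_, ?_, x2⟩, hxk⟩
    · rintro _ ⟨a, ha, rfl⟩
      change (x.q ∘ₗ (w s).p) a ∈ D₁
      rw [e1 a ha]
      exact a1 ha
    · have e3 : D₁.map (x.q ∘ₗ (w s).p) = D₁.map (x.q ∘ₗ x.p) :=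
        SetLike.coe_injective (Set.image_congr e1)
      rw [← a2, ← Submodule.map_comp]
      exact congrArg (fun S : Submodule ℂ D => finrank ℂ S) e3
  have hp's : Function.Surjective p' :=
    h.symm.surjective.comp ((LinearMap.range_eq_top.1 ys).comp g.surjective)
  refine linked_of_line (fun g hg z hz => ⟨twist_mem_piS hg hz.1, ?_⟩) w x.p p' x.q x.q
    (fun s => rfl) ?_ ?_ g hgD ?_ ⟨hx, hxk⟩ ⟨h.symm, ?_⟩ (hwA 1 (by simpa using hp's))
  · rw [ADHM.qRank_twist]; exact hz.2
  · intro s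
    rw [← add_smul, sub_add_cancel, one_smul]
  · refine (finite_not_surjective_line x.p p' (LinearMap.range_eq_top.1 xs)).subset
      fun s hs hs' => hs (hwA s hs')
  · ext a <;> simp [w]
  · refine twist_smul_eq_of g h (fun a => ?_) hh'
    rw [← hhp]
    simp [w]

end Strata

/-! ### Irreducible components from two opposite stratifications -/

section Topology

theorem closure_eq_closure_inter_of_isPreirreducible {X : Type*} [TopologicalSpace X] {A O : Set X}
    (hA : IsPreirreducible A) (hO : IsOpen O) (h : (A ∩ O).Nonempty) :
    closure A = closure (A ∩ O) := by
  refine le_antisymm (closure_minimal (fun x hx => ?_) isClosed_closure)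
    (closure_mono Set.inter_subset_left)
  rw [mem_closure_iff]
  intro U hU hxU
  obtain ⟨y, hyA, hyU, hyO⟩ := hA U O hU hO ⟨x, hx, hxU⟩ h
  exact ⟨y, hyU, hyA, hyO⟩

/-- Two lower semicontinuous functions with irreducible level sets and bounded sum `a + b ≤ M`, such
that every nonempty level set of `a` contains points with `a + b = M`. -/
structure OppositeStrata {X : Type*} [TopologicalSpace X] (a b : X → ℕ) (M : ℕ) : Prop where
  isOpen_left : ∀ k, IsOpen {x | k ≤ a x}
  isOpen_right : ∀ k, IsOpen {x | k ≤ b x}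
  isPreirreducible_left : ∀ k, IsPreirreducible {x | a x = k}
  isPreirreducible_right : ∀ k, IsPreirreducible {x | b x = k}
  add_le : ∀ x, a x + b x ≤ M
  exists_add_eq : ∀ x, ∃ y, a y = a x ∧ a y + b y = M

namespace OppositeStrata

variable {X : Type*} [TopologicalSpace X] {a b : X → ℕ} {M : ℕ} (h : OppositeStrata a b M)
include h

/-- The locus `a = k`, `b = M - k` is open in both level sets, hence dense in both. -/
theorem closure_left_eq_closure_right {k : ℕ} (hk : {x | a x = k}.Nonempty) :
    closure {x | a x = k} = closure {x | b x = M - k} := by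
  obtain ⟨x, rfl⟩ := hk
  obtain ⟨y, hyx, hy⟩ := h.exists_add_eq x
  have e : {z | a z = a x} ∩ {z | M - a x ≤ b z} = {z | b z = M - a x} ∩ {z | a x ≤ a z} := by
    ext z
    have := h.add_le z
    simp only [Set.mem_inter_iff, Set.mem_ofPred_eq]
    omega
  have hy1 : y ∈ {z | a z = a x} ∩ {z | M - a x ≤ b z} := ⟨hyx, by
    simp only [Set.mem_ofPred_eq]; omega⟩
  rw [closure_eq_closure_inter_of_isPreirreducible (h.isPreirreducible_left _)
    (h.isOpen_right (M - a x)) ⟨y, hy1⟩, e,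
    ← closure_eq_closure_inter_of_isPreirreducible (h.isPreirreducible_right _)
    (h.isOpen_left (a x)) ⟨y, e ▸ hy1⟩]

/-- There are no inclusions between the closures of the level sets of `a`: passing to the boundary
of a level set `a = k`, the function `a` decreases, while the generic value `M - k` of `b` does not
increase. -/
theorem eq_of_closure_subset {k k' : ℕ} (hk : {x | a x = k}.Nonempty)
    (hkk : closure {x | a x = k} ⊆ closure {x | a x = k'}) : k = k' := by
  obtain ⟨x, rfl⟩ := hk
  obtain ⟨y, hyx, hy⟩ := h.exists_add_eq x
  have hyc : y ∈ closure {x | a x = k'} := hkk (subset_closure hyx)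
  rw [mem_closure_iff] at hyc
  obtain ⟨z, hz, hz'⟩ := hyc _ (h.isOpen_left (a x)) hyx.ge
  obtain ⟨w, hw, hw'⟩ := hyc _ (h.isOpen_right (M - a x)) (by
    simp only [Set.mem_ofPred_eq]; omega)
  have := h.add_le w
  have := h.add_le x
  simp only [Set.mem_ofPred_eq] at hz hz' hw hw'
  omega

theorem exists_subset_closure {s : Set X} (hs : IsIrreducible s) :
    ∃ k, {x | a x = k}.Nonempty ∧ s ⊆ closure {x | a x = k} := by
  classical
  obtain ⟨t, ht, hst⟩ := isIrreducible_iff_sUnion_isClosed.1 hs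
    ((Finset.range (M + 1)).image fun k => closure {x | a x = k})
    (by simp only [Finset.mem_image]; rintro _ ⟨k, -, rfl⟩; exact isClosed_closure)
    (fun x _ => by
      refine ⟨closure {y | a y = a x}, ?_, subset_closure rfl⟩
      have := h.add_le x
      exact Finset.mem_coe.2 (Finset.mem_image.2 ⟨a x, Finset.mem_range.2 (by omega), rfl⟩))
  obtain ⟨k, -, rfl⟩ := Finset.mem_image.1 ht
  exact ⟨k, closure_nonempty_iff.1 (hs.nonempty.mono hst), hst⟩

theorem closure_mem_irreducibleComponents {k : ℕ} (hk : {x | a x = k}.Nonempty) :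
    closure {x | a x = k} ∈ irreducibleComponents X := by
  refine ⟨⟨hk.closure, (h.isPreirreducible_left k).closure⟩, fun s hs hks => ?_⟩
  obtain ⟨k', -, hk'⟩ := h.exists_subset_closure hs
  rwa [h.eq_of_closure_subset hk (hks.trans hk')]

theorem exists_eq_closure {s : Set X} (hs : s ∈ irreducibleComponents X) :
    ∃ k, {x | a x = k}.Nonempty ∧ s = closure {x | a x = k} := by
  obtain ⟨k, hk, hsk⟩ := h.exists_subset_closure hs.1
  exact ⟨k, hk, hsk.antisymm (hs.2 ⟨hk.closure, (h.isPreirreducible_left k).closure⟩ hsk)⟩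

end OppositeStrata

end Topology

/-! ### Restriction, quotient and reduction of a datum -/

section Reduction

variable {D V : Type*} [AddCommGroup D] [Module ℂ D] [AddCommGroup V] [Module ℂ V]
  {D₁ : Submodule ℂ D} {v₁ v₂ : ℕ}

theorem mem_piSS_iff [FiniteDimensional ℂ V] {z : ADHM D V} :
    z ∈ piSS V D₁ v₁ v₂ ↔ z ∈ piS V D₁ v₁ v₂ ∧ z.qRank = finrank ℂ V := by
  refine and_congr_right fun _ => ?_
  have := z.q.finrank_range_add_finrank_ker
  rw [ADHM.CoStable, ← Submodule.finrank_eq_zero (R := ℂ), ADHM.qRank]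
  omega

/-- Reduction modulo `ker q` gives a point of the multiplicity variety. -/
theorem exists_isRed {T : Type*} [AddCommGroup T] [Module ℂ T] [FiniteDimensional ℂ T]
    [FiniteDimensional ℂ V] {z : ADHM D V} (hz : z ∈ piS V D₁ v₁ v₂) (h : z.qRank = finrank ℂ T) :
    ∃ z₀ ∈ piSS T D₁ v₁ v₂, IsRed z z₀ := by
  obtain ⟨hs, hD, h3, h4⟩ := mem_piS_iff.1 hz
  let e : (V ⧸ LinearMap.ker z.q) ≃ₗ[ℂ] T :=
    LinearEquiv.ofFinrankEq _ _ (z.q.quotKerEquivRange.finrank_eq.trans h)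
  let π : V →ₗ[ℂ] T := e.toLinearMap ∘ₗ (LinearMap.ker z.q).mkQ
  have hπ : Function.Surjective π := e.surjective.comp (Submodule.mkQ_surjective _)
  have hkπ : LinearMap.ker π = LinearMap.ker z.q := by
    rw [LinearMap.ker_comp, LinearEquiv.ker, Submodule.comap_bot, Submodule.ker_mkQ]
  let q₀ : T →ₗ[ℂ] D := (LinearMap.ker z.q).liftQ z.q le_rfl ∘ₗ e.symm.toLinearMap
  have hqπ : ∀ x, q₀ (π x) = z.q x := fun x => by simp [q₀, π]
  have hqπ' : q₀ ∘ₗ π = z.q := LinearMap.ext hqπ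
  let z₀ : ADHM D T := ⟨π ∘ₗ z.p, q₀, by
    refine LinearMap.ext fun x => ?_
    obtain ⟨x, rfl⟩ := hπ x
    rw [LinearMap.comp_apply, hqπ, LinearMap.comp_apply, z.p_q_apply, map_zero]
    rfl⟩
  refine ⟨z₀, mem_piSS_iff.2 ⟨mem_piS_iff.2 ⟨?_, ?_, ?_, ?_⟩, ?_⟩, π, hπ, hkπ, rfl, hqπ'⟩
  · exact LinearMap.range_eq_top.2 (hπ.comp (LinearMap.range_eq_top.1 hs))
  · rintro _ ⟨x, hx, rfl⟩
    change q₀ (π (z.p x)) ∈ D₁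
    rw [hqπ]
    exact hD (Submodule.mem_map_of_mem hx)
  · have hc : z₀.q ∘ₗ z₀.p = z.q ∘ₗ z.p := LinearMap.ext fun x => hqπ _
    rw [← Submodule.map_comp, hc, Submodule.map_comp, h3]
  · rw [← LinearMap.range_comp_of_range_eq_top _ (LinearMap.range_eq_top.2 hπ),
      LinearMap.comp_assoc, hqπ', h4]
  · rw [ADHM.qRank, ← LinearMap.range_comp_of_range_eq_top _ (LinearMap.range_eq_top.2 hπ), hqπ',
      ← h, ADHM.qRank]

variable [FiniteDimensional ℂ D]

/-- A datum compatible with `D₁` restricts to a point of `𝔐ˢ(d₁, v₁, dim p(D₁))`. -/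
theorem exists_isSub {V₁ : Type*} [AddCommGroup V₁] [Module ℂ V₁] [FiniteDimensional ℂ V₁]
    {z : ADHM D V} (hz : z ∈ piS V D₁ v₁ v₂) (h : z.subDim D₁ = finrank ℂ V₁) :
    ∃ z₁ ∈ lambdaS D₁ V₁ v₁, IsSub D₁ z z₁ := by
  obtain ⟨-, hD, h3, -⟩ := mem_piS_iff.1 hz
  let e : V₁ ≃ₗ[ℂ] D₁.map z.p := LinearEquiv.ofFinrankEq _ _ h.symm
  let i : V₁ →ₗ[ℂ] V := (D₁.map z.p).subtype ∘ₗ e.toLinearMap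
  have hi : Function.Injective i := Subtype.val_injective.comp e.injective
  have hri : LinearMap.range i = D₁.map z.p := by
    rw [LinearMap.range_comp, LinearEquiv.range, Submodule.map_top, Submodule.range_subtype]
  have hqi : ∀ x, (z.q ∘ₗ i) x ∈ D₁ := fun x => hD (e x).2
  let p₁ : D₁ →ₗ[ℂ] V₁ := e.symm.toLinearMap ∘ₗ z.p.submoduleMap D₁
  have hip : ∀ x, i (p₁ x) = z.p x := fun x =>
    congrArg Subtype.val (e.apply_symm_apply (z.p.submoduleMap D₁ x))
  let z₁ : ADHM D₁ V₁ := ⟨p₁, (z.q ∘ₗ i).codRestrict D₁ hqi, by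
    refine LinearMap.ext fun x => hi ?_
    rw [LinearMap.zero_apply, map_zero]
    exact (hip _).trans (z.p_q_apply _)⟩
  refine ⟨z₁, mem_lambdaS_iff.2 ⟨?_, ?_⟩, i, hi, hri, LinearMap.ext hip, rfl⟩
  · exact LinearMap.range_eq_top.2 (e.symm.surjective.comp (z.p.submoduleMap_surjective D₁))
  · have : D₁.subtype ∘ₗ z₁.q = z.q ∘ₗ i := rfl
    rw [ADHM.qRank, ← Submodule.finrank_map_subtype_eq, ← LinearMap.range_comp, this,
      LinearMap.range_comp, hri, h3]

/-- A datum compatible with `D₁` induces a point of `𝔐ˢ(d₂, v₂, dim V - dim p(D₁))` on the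
quotients. -/
theorem exists_isQuot [FiniteDimensional ℂ V] {V₂ : Type*} [AddCommGroup V₂] [Module ℂ V₂]
    [FiniteDimensional ℂ V₂]
    {z : ADHM D V} (hz : z ∈ piS V D₁ v₁ v₂) (h : finrank ℂ V₂ + z.subDim D₁ = finrank ℂ V) :
    ∃ z₂ ∈ lambdaS (D ⧸ D₁) V₂ v₂, IsQuot D₁ z z₂ := by
  obtain ⟨hs, hD, -, h4⟩ := mem_piS_iff.1 hz
  have hq := (D₁.map z.p).finrank_quotient_add_finrank
  have hu : finrank ℂ (D₁.map z.p) = z.subDim D₁ := rfl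
  let e : (V ⧸ D₁.map z.p) ≃ₗ[ℂ] V₂ := LinearEquiv.ofFinrankEq _ _ (by omega)
  let π : V →ₗ[ℂ] V₂ := e.toLinearMap ∘ₗ (D₁.map z.p).mkQ
  have hπ : Function.Surjective π := e.surjective.comp (Submodule.mkQ_surjective _)
  have hkπ : LinearMap.ker π = D₁.map z.p := by
    rw [LinearMap.ker_comp, LinearEquiv.ker, Submodule.comap_bot, Submodule.ker_mkQ]
  let q₂ : V₂ →ₗ[ℂ] D ⧸ D₁ := (D₁.map z.p).mapQ D₁ z.q hD ∘ₗ e.symm.toLinearMap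
  have hqπ : ∀ x, q₂ (π x) = D₁.mkQ (z.q x) := fun x => by simp [q₂, π]
  let p₂ : (D ⧸ D₁) →ₗ[ℂ] V₂ :=
    e.toLinearMap ∘ₗ D₁.mapQ (D₁.map z.p) z.p (Submodule.le_comap_map _ _)
  have hpπ : ∀ x, p₂ (D₁.mkQ x) = π (z.p x) := fun x => rfl
  let z₂ : ADHM (D ⧸ D₁) V₂ := ⟨p₂, q₂, by
    refine LinearMap.ext fun x => ?_
    obtain ⟨x, rfl⟩ := hπ x
    rw [LinearMap.comp_apply, hqπ, hpπ, z.p_q_apply, map_zero]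
    rfl⟩
  refine ⟨z₂, mem_lambdaS_iff.2 ⟨?_, ?_⟩, π, hπ, hkπ, rfl, LinearMap.ext hqπ⟩
  · refine LinearMap.range_eq_top.2 fun x => ?_
    obtain ⟨x, rfl⟩ := hπ x
    obtain ⟨x, rfl⟩ := LinearMap.range_eq_top.1 hs x
    exact ⟨_, hpπ x⟩
  · have : z₂.q ∘ₗ π = D₁.mkQ ∘ₗ z.q := LinearMap.ext hqπ
    rw [ADHM.qRank, ← LinearMap.range_comp_of_range_eq_top _ (LinearMap.range_eq_top.2 hπ), this,
      h4]

end Reduction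

/-! ### The varieties and their components -/

section Components

universe u

variable {D : Type u} [AddCommGroup D] [Module ℂ D]

theorem preirreducibleSpace_orbitSpace {V : Type*} [AddCommGroup V] [Module ℂ V]
    {S : Set (ADHM D V)} (h : ∀ x ∈ S, ∀ y ∈ S, Linked S x y) :
    PreirreducibleSpace (OrbitSpace S) := by
  have e : orbitsOf S S = Set.univ := Set.eq_univ_of_forall fun x => by
    obtain ⟨z, rfl⟩ := Quotient.exists_rep x
    exact ⟨z.1, z.2, z.2, rfl⟩
  exact ⟨e ▸ isPreirreducible_orbitsOf le_rfl h⟩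

theorem nonempty_orbitSpace_iff {V : Type*} [AddCommGroup V] [Module ℂ V]
    {S : Set (ADHM D V)} : Nonempty (OrbitSpace S) ↔ S.Nonempty := by
  constructor
  · rintro ⟨x⟩
    obtain ⟨z, -⟩ := Quotient.exists_rep x
    exact ⟨z.1, z.2⟩
  · rintro ⟨z, hz⟩
    exact ⟨OrbitSpace.mk z hz⟩

theorem irreducibleSpace_iff_and_isEmpty_iff {X : Type*} [TopologicalSpace X]
    [PreirreducibleSpace X] {c : Prop} (h : Nonempty X ↔ c) :
    (IrreducibleSpace X ↔ c) ∧ (IsEmpty X ↔ ¬ c) :=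
  ⟨⟨fun hX => h.1 hX.toNonempty, fun hc => { toNonempty := h.2 hc }⟩, by
    rw [← h, not_nonempty_iff]⟩

theorem eq_univ_of_mem_irreducibleComponents {X : Type*} [TopologicalSpace X]
    [PreirreducibleSpace X] {s : Set X} (hs : s ∈ irreducibleComponents X) : s = Set.univ :=
  have h : IsIrreducible (Set.univ : Set X) :=
    ⟨hs.1.nonempty.mono (Set.subset_univ s), PreirreducibleSpace.isPreirreducible_univ⟩
  Set.univ_subset_iff.1 (hs.2 h (Set.subset_univ s))

theorem univ_mem_irreducibleComponents {X : Type*} [TopologicalSpace X]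
    [PreirreducibleSpace X] [Nonempty X] : Set.univ ∈ irreducibleComponents X :=
  ⟨⟨Set.univ_nonempty, PreirreducibleSpace.isPreirreducible_univ⟩, fun _ _ _ => Set.subset_univ _⟩

variable {D₁ : Submodule ℂ D} {v₁ v₂ : ℕ}

/-- `dim p(D₁)` as a function on the tensor product variety. -/
noncomputable def TensorVar.subDim (v : ℕ) : TensorVar D₁ v v₁ v₂ → ℕ :=
  OrbitSpace.lift (ADHM.subDim D₁) (ADHM.subDim_smul D₁)

/-- The rank of `q` as a function on the tensor product variety. -/
noncomputable def TensorVar.qRank (v : ℕ) : TensorVar D₁ v v₁ v₂ → ℕ :=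
  OrbitSpace.lift ADHM.qRank ADHM.qRank_smul

theorem TensorVar.setOf_subDim_eq (v k : ℕ) :
    {x : TensorVar D₁ v v₁ v₂ | TensorVar.subDim v x = k} =
      orbitsOf _ {z | z ∈ piS (Fin v → ℂ) D₁ v₁ v₂ ∧ z.subDim D₁ = k} := by
  ext x
  constructor
  · intro hx
    obtain ⟨z, rfl⟩ := Quotient.exists_rep x
    exact ⟨z.1, z.2, ⟨z.2, hx⟩, rfl⟩
  · rintro ⟨z, hz, hz', rfl⟩
    exact hz'.2

theorem TensorVar.setOf_qRank_eq (v k : ℕ) :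
    {x : TensorVar D₁ v v₁ v₂ | TensorVar.qRank v x = k} =
      orbitsOf _ {z | z ∈ piS (Fin v → ℂ) D₁ v₁ v₂ ∧ z.qRank = k} := by
  ext x
  constructor
  · intro hx
    obtain ⟨z, rfl⟩ := Quotient.exists_rep x
    exact ⟨z.1, z.2, ⟨z.2, hx⟩, rfl⟩
  · rintro ⟨z, hz, hz', rfl⟩
    exact hz'.2

variable [FiniteDimensional ℂ D]

instance (v₀ v : ℕ) : PreirreducibleSpace (QuiverVar D v₀ v) := by
  refine preirreducibleSpace_orbitSpace ?_
  have e : lambdaS D (Fin v → ℂ) v₀ =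
      {z | z ∈ piS (Fin v → ℂ) (⊥ : Submodule ℂ D) 0 v₀ ∧ z.subDim ⊥ = 0} := by
    ext z
    simp [lambdaS_eq_piS_bot, ADHM.subDim]
  rw [e]
  exact fun x hx y hy => linked_of_subDim_eq 0 hx hy

theorem nonempty_quiverVar_iff (v₀ v : ℕ) :
    Nonempty (QuiverVar D v₀ v) ↔ v₀ ≤ v ∧ v + v₀ ≤ finrank ℂ D := by
  have hD := (⊥ : Submodule ℂ D).finrank_quotient_add_finrank
  have hb := finrank_bot ℂ D
  have hV : finrank ℂ (Fin v → ℂ) = v := Module.finrank_fin_fun ℂ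
  rw [nonempty_orbitSpace_iff, lambdaS_eq_piS_bot]
  constructor
  · rintro ⟨z, hz⟩
    have := invariants_le hz
    omega
  · rintro ⟨h1, h2⟩
    obtain ⟨z, hz, -⟩ := exists_mem_piS (V := Fin v → ℂ) (⊥ : Submodule ℂ D) (v₁ := 0) (v₂ := v₀)
      (u₁ := 0) (u₂ := v) (by omega) le_rfl (by omega) h1 (by omega)
    exact ⟨z, hz⟩

instance (v₀ : ℕ) : PreirreducibleSpace (MultVar D₁ v₀ v₁ v₂) := by
  refine preirreducibleSpace_orbitSpace ?_
  have e : piSS (Fin v₀ → ℂ) D₁ v₁ v₂ =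
      {z | z ∈ piS (Fin v₀ → ℂ) D₁ v₁ v₂ ∧ z.qRank = finrank ℂ (Fin v₀ → ℂ)} := by
    ext z
    exact mem_piSS_iff
  rw [e]
  exact fun x hx y hy => linked_of_qRank_eq _ hx hy

theorem nonempty_multVar_iff (v₀ : ℕ) :
    Nonempty (MultVar D₁ v₀ v₁ v₂) ↔
      v₁ + v₂ ≤ v₀ ∧ v₀ + v₂ ≤ finrank ℂ (D ⧸ D₁) + v₁ ∧ v₀ + v₁ ≤ finrank ℂ D₁ + v₂ := by
  have hV : finrank ℂ (Fin v₀ → ℂ) = v₀ := Module.finrank_fin_fun ℂ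
  rw [nonempty_orbitSpace_iff]
  constructor
  · rintro ⟨z, hz⟩
    obtain ⟨hz, hr⟩ := mem_piSS_iff.1 hz
    have := invariants_le hz
    omega
  · rintro ⟨h1, h2, h3⟩
    obtain ⟨z, hz, -, hr⟩ := exists_mem_piS (V := Fin v₀ → ℂ) D₁ (v₁ := v₁) (v₂ := v₂)
      (u₁ := v₁) (u₂ := v₀ - v₁) (by omega) le_rfl (by omega) (by omega) (by omega)
    exact ⟨z, mem_piSS_iff.2 ⟨hz, by omega⟩⟩

/-- On the locus `dim p(D₁) = u` the generic rank of `q` is `min(v + v₁, d₁ + v₂) - u`. -/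
theorem TensorVar.oppositeStrata (v : ℕ) :
    OppositeStrata (TensorVar.subDim (D₁ := D₁) (v₁ := v₁) (v₂ := v₂) v) (TensorVar.qRank v)
      (min (v + v₁) (finrank ℂ D₁ + v₂)) := by
  have hV : finrank ℂ (Fin v → ℂ) = v := Module.finrank_fin_fun ℂ
  refine ⟨fun k => ?_, fun k => ?_, fun k => ?_, fun k => ?_, fun x => ?_, fun x => ?_⟩
  · exact OrbitSpace.isOpen_le_lift _ _ k (ADHM.isOpen_le_subDim D₁ k)
  · exact OrbitSpace.isOpen_le_lift _ _ k (ADHM.isOpen_le_qRank k)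
  · rw [TensorVar.setOf_subDim_eq]
    exact isPreirreducible_orbitsOf (fun z hz => hz.1) fun x hx y hy =>
      linked_of_subDim_eq k hx hy
  · rw [TensorVar.setOf_qRank_eq]
    exact isPreirreducible_orbitsOf (fun z hz => hz.1) fun x hx y hy =>
      linked_of_qRank_eq k hx hy
  · obtain ⟨z, rfl⟩ := Quotient.exists_rep x
    have := invariants_le z.2
    change z.1.subDim D₁ + z.1.qRank ≤ _
    omega
  · obtain ⟨z, rfl⟩ := Quotient.exists_rep x
    have := invariants_le z.2
    obtain ⟨w, hw, hw1, hw2⟩ := exists_mem_piS (V := Fin v → ℂ) D₁ (v₁ := v₁) (v₂ := v₂)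
      (u₁ := z.1.subDim D₁) (u₂ := v - z.1.subDim D₁) (by omega) (by omega) (by omega) (by omega)
      (by omega)
    refine ⟨OrbitSpace.mk w hw, hw1, ?_⟩
    change w.subDim D₁ + w.qRank = _
    omega

theorem TensorVar.nonempty_subDim_eq_iff (v k : ℕ) :
    {x : TensorVar D₁ v v₁ v₂ | TensorVar.subDim v x = k}.Nonempty ↔
      v₁ ≤ k ∧ k + v₁ ≤ finrank ℂ D₁ ∧ k + v₂ ≤ v ∧ v + v₂ ≤ finrank ℂ (D ⧸ D₁) + k := by
  have hV : finrank ℂ (Fin v → ℂ) = v := Module.finrank_fin_fun ℂ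
  rw [TensorVar.setOf_subDim_eq]
  constructor
  · rintro ⟨_, z, hz, hz', rfl⟩
    have := invariants_le hz
    have := hz'.2
    omega
  · rintro ⟨h1, h2, h3, h4⟩
    obtain ⟨w, hw, hw1, hw2⟩ := exists_mem_piS (V := Fin v → ℂ) D₁ (v₁ := v₁) (v₂ := v₂)
      (u₁ := k) (u₂ := v - k) (by omega) (by omega) (by omega) (by omega) (by omega)
    exact ⟨_, w, hw, ⟨hw, hw1⟩, rfl⟩

theorem alphaInv_eq (a : MComp D₁ v₁ × MComp (D ⧸ D₁) v₂) :
    alphaInv D₁ a = ⟨a.1.1 + a.2.1, closure {x | TensorVar.subDim _ x = a.1.1}⟩ := by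
  have hV : finrank ℂ (Fin (a.1.1 + a.2.1) → ℂ) = a.1.1 + a.2.1 := Module.finrank_fin_fun ℂ
  have hV₁ : finrank ℂ (Fin a.1.1 → ℂ) = a.1.1 := Module.finrank_fin_fun ℂ
  have hV₂ : finrank ℂ (Fin a.2.1 → ℂ) = a.2.1 := Module.finrank_fin_fun ℂ
  rw [TensorVar.setOf_subDim_eq]
  refine Sigma.ext rfl (heq_of_eq (congrArg closure (Set.ext fun x => ?_)))
  constructor
  · rintro ⟨z, hz, rfl, ⟨z₁, -, ⟨i, hi, hr, -⟩, -⟩, -⟩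
    refine ⟨z, hz, ⟨hz, ?_⟩, rfl⟩
    rw [ADHM.subDim, ← hr, LinearMap.finrank_range_of_inj hi, hV₁]
  · rintro ⟨z, hz, hz', rfl⟩
    obtain ⟨z₁, h₁, hz₁⟩ := exists_isSub hz (hz'.2.trans hV₁.symm)
    obtain ⟨z₂, h₂, hz₂⟩ := exists_isQuot (V₂ := Fin a.2.1 → ℂ) hz (by rw [hz'.2]; omega)
    refine ⟨z, hz, rfl, ⟨z₁, h₁, hz₁, ?_⟩, ⟨z₂, h₂, hz₂, ?_⟩⟩
    · rw [eq_univ_of_mem_irreducibleComponents a.1.2.2]; trivial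
    · rw [eq_univ_of_mem_irreducibleComponents a.2.2.2]; trivial

theorem betaInv_eq (b : Σ v₀ : ℕ, SComp D₁ v₀ v₁ v₂ × MComp D v₀) :
    betaInv D₁ b = ⟨b.2.2.1, closure {x | TensorVar.qRank _ x = b.1}⟩ := by
  have hT : finrank ℂ (Fin b.1 → ℂ) = b.1 := Module.finrank_fin_fun ℂ
  rw [TensorVar.setOf_qRank_eq]
  refine Sigma.ext rfl (heq_of_eq (congrArg closure (Set.ext fun x => ?_)))
  constructor
  · rintro ⟨z, hz, hm, rfl, -⟩
    exact ⟨z, hz, ⟨hz, (mem_lambdaS_iff.1 hm).2⟩, rfl⟩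
  · rintro ⟨z, hz, hz', rfl⟩
    obtain ⟨z₀, h₀, hz₀⟩ := exists_isRed hz (hz'.2.trans hT.symm)
    refine ⟨z, hz, mem_lambdaS_iff.2 ⟨(mem_piS_iff.1 hz).1, hz'.2⟩, rfl, ?_, z₀, h₀, hz₀, ?_⟩
    · rw [eq_univ_of_mem_irreducibleComponents b.2.2.2.2]; trivial
    · rw [eq_univ_of_mem_irreducibleComponents b.2.1.2]; trivial

end Components

/-! ### Crystals -/

section Crystals

/-- A local form of the axioms of a normal crystal: `ε` and `φ` are nonnegative and vanish exactly
where `e` and `f` do. -/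
structure CrystalData.IsRegular {A : Type*} (C : CrystalData A) : Prop where
  e_spec : ∀ a b, C.e a = some b →
    C.wt b = C.wt a + 2 ∧ C.φ b = C.φ a + 1 ∧ C.ε b = C.ε a - 1
  f_spec : ∀ a b, C.f a = some b →
    C.wt b = C.wt a - 2 ∧ C.φ b = C.φ a - 1 ∧ C.ε b = C.ε a + 1
  wt_eq : ∀ a, C.wt a = C.φ a - C.ε a
  f_iff_e : ∀ a b, C.f a = some b ↔ C.e b = some a
  ε_nonneg : ∀ a, 0 ≤ C.ε a
  φ_nonneg : ∀ a, 0 ≤ C.φ a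
  e_eq_none : ∀ a, C.e a = none ↔ C.ε a = 0
  f_eq_none : ∀ a, C.f a = none ↔ C.φ a = 0

theorem iterOp_ne_none_iff {A : Type*} {g : A → Option A} {n : A → ℤ}
    (h : ∀ a b, g a = some b → n b = n a - 1) (h0 : ∀ a, g a = none ↔ n a = 0)
    (hn : ∀ a, 0 ≤ n a) (k : ℕ) (a : A) : iterOp g k a ≠ none ↔ (k : ℤ) ≤ n a := by
  induction k generalizing a with
  | zero => simpa [iterOp] using hn a
  | succ k ih =>
    have hs : iterOp g (k + 1) a = (fun o : Option A => o.bind g)^[k] (g a) := rfl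
    rw [hs]
    cases hg : g a with
    | none =>
      have hnone : (fun o : Option A => o.bind g)^[k] none = none :=
        Function.iterate_fixed rfl k
      have := (h0 a).1 hg
      simp only [hnone, ne_eq, not_true_eq_false, false_iff]
      omega
    | some b =>
      have := h a b hg
      rw [show (fun o : Option A => o.bind g)^[k] (some b) = iterOp g k b from rfl, ih]
      omega

theorem CrystalData.IsRegular.isNormalCrystal {A : Type*} {C : CrystalData A}
    (h : C.IsRegular) : C.IsNormalCrystal where
  e_spec := h.e_spec
  f_spec := h.f_spec
  wt_eq := h.wt_eq
  f_iff_e := h.f_iff_e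
  ε_eq a := by
    obtain ⟨n, hn⟩ := Int.eq_ofNat_of_zero_le (h.ε_nonneg a)
    have key := iterOp_ne_none_iff (fun a b hab => (h.e_spec a b hab).2.2) h.e_eq_none h.ε_nonneg
    refine ⟨n, hn, (key n a).2 hn.ge, fun k hk => ?_⟩
    have := (key k a).1 hk
    omega
  φ_eq a := by
    obtain ⟨n, hn⟩ := Int.eq_ofNat_of_zero_le (h.φ_nonneg a)
    have key := iterOp_ne_none_iff (fun a b hab => (h.f_spec a b hab).2.1) h.f_eq_none h.φ_nonneg
    refine ⟨n, hn, (key n a).2 hn.ge, fun k hk => ?_⟩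
    have := (key k a).1 hk
    omega

theorem trivialCrystal_isRegular (A : Type*) : (trivialCrystal A).IsRegular := by
  constructor <;> simp [trivialCrystal]

theorem CrystalData.IsRegular.tensor {A B : Type*} {X : CrystalData A} {Y : CrystalData B}
    (hX : X.IsRegular) (hY : Y.IsRegular) : (X.tensor Y).IsRegular where
  e_spec := by
    rintro ⟨a, b⟩ c h
    simp only [CrystalData.tensor] at h ⊢
    split_ifs at h with hc
    · obtain ⟨a', ha, rfl⟩ := Option.map_eq_some_iff.1 h
      have := hX.e_spec _ _ ha
      dsimp only
      omega
    · obtain ⟨b', hb, rfl⟩ := Option.map_eq_some_iff.1 h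
      have := hY.e_spec _ _ hb
      dsimp only
      omega
  f_spec := by
    rintro ⟨a, b⟩ c h
    simp only [CrystalData.tensor] at h ⊢
    split_ifs at h with hc
    · obtain ⟨a', ha, rfl⟩ := Option.map_eq_some_iff.1 h
      have := hX.f_spec _ _ ha
      dsimp only
      omega
    · obtain ⟨b', hb, rfl⟩ := Option.map_eq_some_iff.1 h
      have := hY.f_spec _ _ hb
      dsimp only
      omega
  wt_eq := by
    rintro ⟨a, b⟩
    have := hX.wt_eq a
    have := hY.wt_eq b
    simp only [CrystalData.tensor]
    omega
  f_iff_e := by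
    rintro ⟨a, b⟩ ⟨a', b'⟩
    simp only [CrystalData.tensor]
    constructor
    · intro h
      split_ifs at h with hc
      · obtain ⟨c, ha, hc'⟩ := Option.map_eq_some_iff.1 h
        obtain ⟨rfl, rfl⟩ := Prod.mk.inj hc'
        have := hX.f_spec _ _ ha
        rw [if_pos (by omega), (hX.f_iff_e _ _).1 ha]
        rfl
      · obtain ⟨c, hb, hc'⟩ := Option.map_eq_some_iff.1 h
        obtain ⟨rfl, rfl⟩ := Prod.mk.inj hc'
        have := hY.f_spec _ _ hb
        rw [if_neg (by omega), (hY.f_iff_e _ _).1 hb]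
        rfl
    · intro h
      split_ifs at h with hc
      · obtain ⟨c, ha, hc'⟩ := Option.map_eq_some_iff.1 h
        obtain ⟨rfl, rfl⟩ := Prod.mk.inj hc'
        have := hX.e_spec _ _ ha
        rw [if_pos (by omega), (hX.f_iff_e _ _).2 ha]
        rfl
      · obtain ⟨c, hb, hc'⟩ := Option.map_eq_some_iff.1 h
        obtain ⟨rfl, rfl⟩ := Prod.mk.inj hc'
        have := hY.e_spec _ _ hb
        rw [if_neg (by omega), (hY.f_iff_e _ _).2 hb]
        rfl
  ε_nonneg := by
    rintro ⟨a, b⟩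
    exact (hX.ε_nonneg a).trans (le_max_left _ _)
  φ_nonneg := by
    rintro ⟨a, b⟩
    exact (hY.φ_nonneg b).trans (le_max_left _ _)
  e_eq_none := by
    rintro ⟨a, b⟩
    have h1 := hX.ε_nonneg a
    have h2 := hX.φ_nonneg a
    simp only [CrystalData.tensor]
    split_ifs with hc
    · rw [Option.map_eq_none_iff, hX.e_eq_none]; omega
    · rw [Option.map_eq_none_iff, hY.e_eq_none]; omega
  f_eq_none := by
    rintro ⟨a, b⟩
    have h1 := hY.ε_nonneg b
    have h2 := hY.φ_nonneg b
    simp only [CrystalData.tensor]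
    split_ifs with hc
    · rw [Option.map_eq_none_iff, hX.f_eq_none]; omega
    · rw [Option.map_eq_none_iff, hY.f_eq_none]; omega

theorem directSumCrystal_isRegular {ι : Type*} {A : ι → Type*} {X : ∀ i, CrystalData (A i)}
    (h : ∀ i, (X i).IsRegular) : (directSumCrystal X).IsRegular where
  e_spec := by
    rintro ⟨i, a⟩ c hc
    obtain ⟨b, hb, rfl⟩ := Option.map_eq_some_iff.1 hc
    exact (h i).e_spec _ _ hb
  f_spec := by
    rintro ⟨i, a⟩ c hc
    obtain ⟨b, hb, rfl⟩ := Option.map_eq_some_iff.1 hc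
    exact (h i).f_spec _ _ hb
  wt_eq c := (h c.1).wt_eq c.2
  f_iff_e := by
    rintro ⟨i, a⟩ ⟨i', a'⟩
    constructor
    · intro hc
      obtain ⟨b, hb, hbc⟩ := Option.map_eq_some_iff.1 hc
      cases hbc
      simp [directSumCrystal, ((h i).f_iff_e _ _).1 hb]
    · intro hc
      obtain ⟨b, hb, hbc⟩ := Option.map_eq_some_iff.1 hc
      cases hbc
      simp [directSumCrystal, ((h i').f_iff_e _ _).2 hb]
  ε_nonneg c := (h c.1).ε_nonneg c.2
  φ_nonneg c := (h c.1).φ_nonneg c.2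
  e_eq_none c := Option.map_eq_none_iff.trans ((h c.1).e_eq_none c.2)
  f_eq_none c := Option.map_eq_none_iff.trans ((h c.1).f_eq_none c.2)

/-- For regular crystals it suffices to compare `ε`, `φ` and the nonzero values of `e`: regularity
determines where `e` and `f` vanish, and `f` is the partial inverse of `e`. -/
theorem IsCrystalIso.of_isRegular {A B : Type*} {X : CrystalData A} {Y : CrystalData B}
    {τ : A ≃ B} (hX : X.IsRegular) (hY : Y.IsRegular) (hε : ∀ a, Y.ε (τ a) = X.ε a)
    (hφ : ∀ a, Y.φ (τ a) = X.φ a) (he : ∀ a b, X.e a = some b → Y.e (τ a) = some (τ b)) :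
    IsCrystalIso X Y τ where
  wt a := by rw [hY.wt_eq, hX.wt_eq, hε, hφ]
  ε := hε
  φ := hφ
  e a := by
    cases h : X.e a with
    | none => exact (hY.e_eq_none _).2 ((hε a).trans ((hX.e_eq_none a).1 h))
    | some b => exact he a b h
  f a := by
    cases h : X.f a with
    | none => exact (hY.f_eq_none _).2 ((hφ a).trans ((hX.f_eq_none a).1 h))
    | some b => exact (hY.f_iff_e _ _).2 (he _ _ ((hX.f_iff_e _ _).1 h))

universe u

variable {D : Type u} [AddCommGroup D] [Module ℂ D] [FiniteDimensional ℂ D] {v₀ : ℕ}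

theorem MComp.bounds (Z : MComp D v₀) : v₀ ≤ Z.1 ∧ Z.1 + v₀ ≤ finrank ℂ D :=
  (nonempty_quiverVar_iff v₀ Z.1).1 (Z.2.2.1.nonempty.to_type)

theorem MComp.exists_fst_eq {v : ℕ} (h : v₀ ≤ v ∧ v + v₀ ≤ finrank ℂ D) :
    ∃ Z : MComp D v₀, Z.1 = v :=
  have := (nonempty_quiverVar_iff v₀ v).2 h
  ⟨⟨v, Set.univ, univ_mem_irreducibleComponents⟩, rfl⟩

instance (v : ℕ) : Subsingleton (irreducibleComponents (QuiverVar D v₀ v)) :=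
  ⟨fun Z Z' => Subtype.ext ((eq_univ_of_mem_irreducibleComponents Z.2).trans
    (eq_univ_of_mem_irreducibleComponents Z'.2).symm)⟩

theorem MComp.ext_fst {Z Z' : MComp D v₀} (h : Z.1 = Z'.1) : Z = Z' := by
  obtain ⟨v, Z⟩ := Z
  obtain ⟨v', Z'⟩ := Z'
  obtain rfl : v = v' := h
  rw [Subsingleton.elim Z Z']

theorem wholeVar_eq_some_iff {v : ℕ} {Z : MComp D v₀} : wholeVar D v₀ v = some Z ↔ Z.1 = v := by
  constructor
  · intro h
    rw [wholeVar] at h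
    split_ifs at h
    rw [← Option.some.inj h]
  · rintro rfl
    have h : Set.univ ∈ irreducibleComponents (QuiverVar D v₀ Z.1) := by
      have := Z.2.2
      rwa [eq_univ_of_mem_irreducibleComponents this] at this
    rw [wholeVar, dif_pos h]
    exact congrArg some (MComp.ext_fst rfl)

theorem crystalM_e_eq_some_iff {Z Z' : MComp D v₀} :
    (crystalM D v₀).e Z = some Z' ↔ Z'.1 + 1 = Z.1 := by
  have := Z'.bounds
  simp only [crystalM]
  split_ifs with h
  · rw [wholeVar_eq_some_iff]; omega
  · simp only [false_iff]; omega

theorem crystalM_f_eq_some_iff {Z Z' : MComp D v₀} :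
    (crystalM D v₀).f Z = some Z' ↔ Z'.1 = Z.1 + 1 := by
  have := Z'.bounds
  simp only [crystalM]
  split_ifs with h
  · rw [wholeVar_eq_some_iff]
  · simp only [false_iff]; omega

variable (D v₀) in
theorem crystalM_isRegular : (crystalM D v₀).IsRegular where
  e_spec Z Z' h := by
    rw [crystalM_e_eq_some_iff] at h
    simp only [crystalM]
    omega
  f_spec Z Z' h := by
    rw [crystalM_f_eq_some_iff] at h
    simp only [crystalM]
    omega
  wt_eq Z := by simp only [crystalM]; omega
  f_iff_e Z Z' := by rw [crystalM_e_eq_some_iff, crystalM_f_eq_some_iff]; omega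
  ε_nonneg Z := by have := Z.bounds; simp only [crystalM]; omega
  φ_nonneg Z := by have := Z.bounds; simp only [crystalM]; omega
  e_eq_none Z := by
    have hZ := Z.bounds
    have hε : (crystalM D v₀).ε Z = Z.1 - v₀ := rfl
    rw [Option.eq_none_iff_forall_ne_some, hε]
    constructor
    · intro h
      by_contra hne
      obtain ⟨Z', hZ'⟩ := MComp.exists_fst_eq (D := D) (v₀ := v₀) (v := Z.1 - 1) (by omega)
      exact h Z' (crystalM_e_eq_some_iff.2 (by omega))
    · intro h Z' hZ'
      have := Z'.bounds
      rw [crystalM_e_eq_some_iff] at hZ'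
      omega
  f_eq_none Z := by
    have hZ := Z.bounds
    have hφ : (crystalM D v₀).φ Z = finrank ℂ D - Z.1 - v₀ := rfl
    rw [Option.eq_none_iff_forall_ne_some, hφ]
    constructor
    · intro h
      by_contra hne
      obtain ⟨Z', hZ'⟩ := MComp.exists_fst_eq (D := D) (v₀ := v₀) (v := Z.1 + 1) (by omega)
      exact h Z' (crystalM_f_eq_some_iff.2 (by omega))
    · intro h Z' hZ'
      have := Z'.bounds
      rw [crystalM_f_eq_some_iff] at hZ'
      omega

end Crystals

/-! ### The tensor decomposition bijection -/

section Decomposition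

universe u

variable {D : Type u} [AddCommGroup D] [Module ℂ D] {D₁ : Submodule ℂ D} {v₁ v₂ : ℕ}

variable (D₁ v₁ v₂) in
/-- The closure of the locus `dim p(D₁) = k` in `²𝔗(d, 𝐝, v, 𝐯)`. -/
noncomputable def subClosure (v k : ℕ) : Σ v : ℕ, Set (TensorVar D₁ v v₁ v₂) :=
  ⟨v, closure {x | TensorVar.subDim v x = k}⟩

variable (D₁ v₁ v₂) in
/-- The closure of the locus `rank q = k` in `²𝔗(d, 𝐝, v, 𝐯)`. -/
noncomputable def rankClosure (v k : ℕ) : Σ v : ℕ, Set (TensorVar D₁ v v₁ v₂) :=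
  ⟨v, closure {x | TensorVar.qRank v x = k}⟩

theorem TComp.toSet_injective :
    Function.Injective (TComp.toSet : TComp D₁ v₁ v₂ → Σ v : ℕ, Set (TensorVar D₁ v v₁ v₂)) := by
  rintro ⟨v, Z⟩ ⟨v', Z'⟩ h
  obtain ⟨rfl, h⟩ := Sigma.mk.inj h
  exact Sigma.ext rfl (heq_of_eq (Subtype.ext (eq_of_heq h)))

instance [FiniteDimensional ℂ D] (v₀ : ℕ) : Subsingleton (SComp D₁ v₀ v₁ v₂) :=
  ⟨fun Z Z' => Subtype.ext ((eq_univ_of_mem_irreducibleComponents Z.2).trans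
    (eq_univ_of_mem_irreducibleComponents Z'.2).symm)⟩

variable [FiniteDimensional ℂ D]

theorem sigma_ext {b b' : Σ v₀ : ℕ, SComp D₁ v₀ v₁ v₂ × MComp D v₀} (h : b.1 = b'.1)
    (h' : b.2.2.1 = b'.2.2.1) : b = b' := by
  obtain ⟨v, S, Z⟩ := b
  obtain ⟨v', S', Z'⟩ := b'
  obtain rfl : v = v' := h
  obtain rfl : Z = Z' := MComp.ext_fst h'
  rw [Subsingleton.elim S S']

theorem SComp.bounds {v₀ : ℕ} (S : SComp D₁ v₀ v₁ v₂) :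
    v₁ + v₂ ≤ v₀ ∧ v₀ + v₂ ≤ finrank ℂ (D ⧸ D₁) + v₁ ∧ v₀ + v₁ ≤ finrank ℂ D₁ + v₂ :=
  (nonempty_multVar_iff v₀).1 (S.2.1.nonempty.to_type)

theorem exists_sigma_eq {v₀ v : ℕ} (h : v₁ + v₂ ≤ v₀ ∧ v₀ + v₂ ≤ finrank ℂ (D ⧸ D₁) + v₁ ∧
    v₀ + v₁ ≤ finrank ℂ D₁ + v₂) (h' : v₀ ≤ v ∧ v + v₀ ≤ finrank ℂ D) :
    ∃ b : Σ v₀ : ℕ, SComp D₁ v₀ v₁ v₂ × MComp D v₀, b.1 = v₀ ∧ b.2.2.1 = v :=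
  have := (nonempty_multVar_iff v₀).2 h
  have ⟨Z, hZ⟩ := MComp.exists_fst_eq h'
  ⟨⟨v₀, ⟨Set.univ, univ_mem_irreducibleComponents⟩, Z⟩, rfl, hZ⟩

theorem subClosure_eq_rankClosure {v k : ℕ}
    (h : v₁ ≤ k ∧ k + v₁ ≤ finrank ℂ D₁ ∧ k + v₂ ≤ v ∧ v + v₂ ≤ finrank ℂ (D ⧸ D₁) + k) :
    subClosure D₁ v₁ v₂ v k =
      rankClosure D₁ v₁ v₂ v (min (v + v₁) (finrank ℂ D₁ + v₂) - k) :=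
  Sigma.ext rfl (heq_of_eq ((TensorVar.oppositeStrata v).closure_left_eq_closure_right
    ((TensorVar.nonempty_subDim_eq_iff v k).2 h)))

theorem subClosure_injective {v k v' k' : ℕ}
    (h : v₁ ≤ k ∧ k + v₁ ≤ finrank ℂ D₁ ∧ k + v₂ ≤ v ∧ v + v₂ ≤ finrank ℂ (D ⧸ D₁) + k)
    (heq : subClosure D₁ v₁ v₂ v k = subClosure D₁ v₁ v₂ v' k') : v = v' ∧ k = k' := by
  obtain ⟨rfl, heq⟩ := Sigma.mk.inj heq
  exact ⟨rfl, (TensorVar.oppositeStrata v).eq_of_closure_subset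
    ((TensorVar.nonempty_subDim_eq_iff v k).2 h) (eq_of_heq heq).subset⟩

theorem exists_toSet_eq_subClosure {v k : ℕ}
    (h : v₁ ≤ k ∧ k + v₁ ≤ finrank ℂ D₁ ∧ k + v₂ ≤ v ∧ v + v₂ ≤ finrank ℂ (D ⧸ D₁) + k) :
    ∃ Z : TComp D₁ v₁ v₂, Z.toSet = subClosure D₁ v₁ v₂ v k :=
  ⟨⟨v, _, (TensorVar.oppositeStrata v).closure_mem_irreducibleComponents
    ((TensorVar.nonempty_subDim_eq_iff v k).2 h)⟩, rfl⟩

theorem TComp.exists_subClosure_eq (Z : TComp D₁ v₁ v₂) :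
    ∃ v k, (v₁ ≤ k ∧ k + v₁ ≤ finrank ℂ D₁ ∧ k + v₂ ≤ v ∧ v + v₂ ≤ finrank ℂ (D ⧸ D₁) + k) ∧
      Z.toSet = subClosure D₁ v₁ v₂ v k := by
  obtain ⟨v, Z, hZ⟩ := Z
  obtain ⟨k, hk, rfl⟩ := (TensorVar.oppositeStrata v).exists_eq_closure hZ
  exact ⟨v, k, (TensorVar.nonempty_subDim_eq_iff v k).1 hk, rfl⟩

theorem alphaInv_eq_subClosure (a : MComp D₁ v₁ × MComp (D ⧸ D₁) v₂) :
    alphaInv D₁ a = subClosure D₁ v₁ v₂ (a.1.1 + a.2.1) a.1.1 := alphaInv_eq a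

theorem betaInv_eq_rankClosure (b : Σ v₀ : ℕ, SComp D₁ v₀ v₁ v₂ × MComp D v₀) :
    betaInv D₁ b = rankClosure D₁ v₁ v₂ b.2.2.1 b.1 := betaInv_eq b

/-- The component that `β₂⁻¹` attaches to `b` is also the closure of a locus `dim p(D₁) = k`. -/
theorem betaInv_eq_subClosure (b : Σ v₀ : ℕ, SComp D₁ v₀ v₁ v₂ × MComp D v₀) :
    ∃ k, (v₁ ≤ k ∧ k + v₁ ≤ finrank ℂ D₁ ∧ k + v₂ ≤ b.2.2.1 ∧
      b.2.2.1 + v₂ ≤ finrank ℂ (D ⧸ D₁) + k) ∧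
      b.1 + k = min (b.2.2.1 + v₁) (finrank ℂ D₁ + v₂) ∧
      betaInv D₁ b = subClosure D₁ v₁ v₂ b.2.2.1 k := by
  have hS := b.2.1.bounds
  have hZ := b.2.2.bounds
  have hD := D₁.finrank_quotient_add_finrank
  have hk : v₁ ≤ min (b.2.2.1 + v₁) (finrank ℂ D₁ + v₂) - b.1 ∧
      min (b.2.2.1 + v₁) (finrank ℂ D₁ + v₂) - b.1 + v₁ ≤ finrank ℂ D₁ ∧
      min (b.2.2.1 + v₁) (finrank ℂ D₁ + v₂) - b.1 + v₂ ≤ b.2.2.1 ∧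
      b.2.2.1 + v₂ ≤ finrank ℂ (D ⧸ D₁) + (min (b.2.2.1 + v₁) (finrank ℂ D₁ + v₂) - b.1) := by
    omega
  refine ⟨_, hk, by omega, ?_⟩
  rw [subClosure_eq_rankClosure hk, betaInv_eq_rankClosure]
  congr 1
  omega

variable (D₁ v₁ v₂) in
theorem exists_isAlpha :
    ∃ α : TComp D₁ v₁ v₂ ≃ MComp D₁ v₁ × MComp (D ⧸ D₁) v₂, IsAlpha α := by
  have hval : ∀ a : MComp D₁ v₁ × MComp (D ⧸ D₁) v₂, v₁ ≤ a.1.1 ∧ a.1.1 + v₁ ≤ finrank ℂ D₁ ∧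
      a.1.1 + v₂ ≤ a.1.1 + a.2.1 ∧ a.1.1 + a.2.1 + v₂ ≤ finrank ℂ (D ⧸ D₁) + a.1.1 := fun a => by
    have := a.1.bounds
    have := a.2.bounds
    omega
  choose F hF using fun a => exists_toSet_eq_subClosure (hval a)
  have hbij : Function.Bijective F := by
    refine ⟨fun a a' h => ?_, fun Z => ?_⟩
    · have h1 := (hF a).symm.trans ((congrArg TComp.toSet h).trans (hF a'))
      have h2 := subClosure_injective (hval a) h1
      exact Prod.ext (MComp.ext_fst (by omega)) (MComp.ext_fst (by omega))
    · obtain ⟨v, k, hk, hZ⟩ := Z.exists_subClosure_eq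
      obtain ⟨a₁, ha₁⟩ := MComp.exists_fst_eq (D := D₁) (v₀ := v₁) (v := k) (by omega)
      obtain ⟨a₂, ha₂⟩ := MComp.exists_fst_eq (D := D ⧸ D₁) (v₀ := v₂) (v := v - k) (by omega)
      refine ⟨(a₁, a₂), TComp.toSet_injective ?_⟩
      rw [hF, hZ]
      dsimp only
      rw [ha₁, ha₂]
      congr 1
      omega
  refine ⟨(Equiv.ofBijective F hbij).symm, fun a => ?_⟩
  rw [Equiv.symm_symm, alphaInv_eq_subClosure]
  exact hF a

variable (D₁ v₁ v₂) in
theorem exists_isBeta :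
    ∃ β : TComp D₁ v₁ v₂ ≃ Σ v₀ : ℕ, SComp D₁ v₀ v₁ v₂ × MComp D v₀, IsBeta β := by
  have hD := D₁.finrank_quotient_add_finrank
  choose k hk hkb hb using fun b => betaInv_eq_subClosure (D₁ := D₁) (v₁ := v₁) (v₂ := v₂) b
  choose F hF using fun b => exists_toSet_eq_subClosure (hk b)
  have hbij : Function.Bijective F := by
    refine ⟨fun b b' h => ?_, fun Z => ?_⟩
    · have h1 := (hF b).symm.trans ((congrArg TComp.toSet h).trans (hF b'))
      have h2 := subClosure_injective (hk b) h1
      have h3 := hkb b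
      have h4 := hkb b'
      exact sigma_ext (by omega) h2.1
    · obtain ⟨v, m, hm, hZ⟩ := Z.exists_subClosure_eq
      obtain ⟨b, hb₁, hb₂⟩ := exists_sigma_eq (D₁ := D₁) (v₁ := v₁) (v₂ := v₂)
        (v₀ := min (v + v₁) (finrank ℂ D₁ + v₂) - m) (v := v) (by omega) (by omega)
      refine ⟨b, TComp.toSet_injective ?_⟩
      have h3 := hkb b
      rw [hF, hZ]
      congr 1
      omega
  refine ⟨(Equiv.ofBijective F hbij).symm, fun b => ?_⟩
  rw [Equiv.symm_symm, hb]
  exact hF b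

/-- The numerical form of `τ₂`, with `v₀ + u₁ = min (u₁ + u₂ + v₁) (d₁ + v₂)`. -/
theorem alpha_symm_trans_beta_spec {α : TComp D₁ v₁ v₂ ≃ MComp D₁ v₁ × MComp (D ⧸ D₁) v₂}
    {β : TComp D₁ v₁ v₂ ≃ Σ v₀ : ℕ, SComp D₁ v₀ v₁ v₂ × MComp D v₀} (hα : IsAlpha α)
    (hβ : IsBeta β) (c : MComp D₁ v₁ × MComp (D ⧸ D₁) v₂) :
    (α.symm.trans β c).1 + c.1.1 = min (c.1.1 + c.2.1 + v₁) (finrank ℂ D₁ + v₂) ∧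
      (α.symm.trans β c).2.2.1 = c.1.1 + c.2.1 := by
  obtain ⟨k, hk, hkb, hb⟩ := betaInv_eq_subClosure (α.symm.trans β c)
  have h1 := hβ (α.symm.trans β c)
  rw [Equiv.trans_apply, Equiv.symm_apply_apply, hα, alphaInv_eq_subClosure,
    ← Equiv.trans_apply, hb] at h1
  have h2 := subClosure_injective hk h1.symm
  omega

theorem crystalM_tensor_isRegular :
    ((crystalM D₁ v₁).tensor (crystalM (D ⧸ D₁) v₂)).IsRegular :=
  (crystalM_isRegular D₁ v₁).tensor (crystalM_isRegular (D ⧸ D₁) v₂)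

theorem crystalSum_isRegular : (directSumCrystal fun v₀ : ℕ =>
    (trivialCrystal (SComp D₁ v₀ v₁ v₂)).tensor (crystalM D v₀)).IsRegular :=
  directSumCrystal_isRegular fun v₀ => (trivialCrystal_isRegular _).tensor (crystalM_isRegular D v₀)

theorem crystalSum_e_eq_some {b b' : Σ v₀ : ℕ, SComp D₁ v₀ v₁ v₂ × MComp D v₀} (h : b'.1 = b.1)
    (h' : b'.2.2.1 + 1 = b.2.2.1) : (directSumCrystal fun v₀ : ℕ =>
      (trivialCrystal (SComp D₁ v₀ v₁ v₂)).tensor (crystalM D v₀)).e b = some b' := by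
  obtain ⟨v, S, Z⟩ := b
  obtain ⟨v', S', Z'⟩ := b'
  obtain rfl : v' = v := h
  have h1 := Z'.bounds
  have h2 : ¬ (crystalM D v').ε Z ≤ 0 := by
    simp only [crystalM]
    dsimp only at h'
    omega
  have h3 : (crystalM D v').e Z = some Z' := crystalM_e_eq_some_iff.2 h'
  have h4 : ((trivialCrystal (SComp D₁ v' v₁ v₂)).tensor (crystalM D v')).e (S, Z) =
      some (S', Z') := by
    refine (if_neg h2).trans ?_
    rw [h3, Subsingleton.elim S S']
    rfl
  exact congrArg (Option.map fun a => (⟨v', a⟩ : Σ v₀ : ℕ, SComp D₁ v₀ v₁ v₂ × MComp D v₀)) h4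

theorem isCrystalIso_alpha_symm_trans_beta
    {α : TComp D₁ v₁ v₂ ≃ MComp D₁ v₁ × MComp (D ⧸ D₁) v₂}
    {β : TComp D₁ v₁ v₂ ≃ Σ v₀ : ℕ, SComp D₁ v₀ v₁ v₂ × MComp D v₀} (hα : IsAlpha α)
    (hβ : IsBeta β) :
    IsCrystalIso ((crystalM D₁ v₁).tensor (crystalM (D ⧸ D₁) v₂))
      (directSumCrystal fun v₀ : ℕ =>
        (trivialCrystal (SComp D₁ v₀ v₁ v₂)).tensor (crystalM D v₀)) (α.symm.trans β) := by
  have hD := D₁.finrank_quotient_add_finrank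
  have hspec := alpha_symm_trans_beta_spec hα hβ
  generalize α.symm.trans β = τ at hspec ⊢
  refine IsCrystalIso.of_isRegular crystalM_tensor_isRegular crystalSum_isRegular
    (fun c => ?_) (fun c => ?_) fun c c' h => ?_
  · have h1 := hspec c
    have h2 := (τ c).2.2.bounds
    simp only [directSumCrystal, CrystalData.tensor, trivialCrystal, crystalM]
    omega
  · have h1 := hspec c
    have h2 := (τ c).2.2.bounds
    simp only [directSumCrystal, CrystalData.tensor, trivialCrystal, crystalM]
    omega
  · have h1 := hspec c
    have h2 := hspec c'
    obtain ⟨a, b⟩ := c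
    simp only [CrystalData.tensor] at h
    split_ifs at h with hc
    · obtain ⟨a', ha, rfl⟩ := Option.map_eq_some_iff.1 h
      rw [crystalM_e_eq_some_iff] at ha
      simp only [crystalM] at hc
      dsimp only at h1 h2
      exact crystalSum_e_eq_some (by omega) (by omega)
    · obtain ⟨b', hb, rfl⟩ := Option.map_eq_some_iff.1 h
      rw [crystalM_e_eq_some_iff] at hb
      simp only [crystalM] at hc
      dsimp only at h1 h2
      exact crystalSum_e_eq_some (by omega) (by omega)

end Decomposition

end SL2Quiver

theorem theorem2p9 {D : Type*} [AddCommGroup D] [Module ℂ D] [FiniteDimensional ℂ D]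
    (D₁ : Submodule ℂ D) (v₁ v₂ : ℕ) :
    -- each quiver variety is irreducible or empty, with the stated range of non-emptiness
    (∀ (v₀ v : ℕ), (IrreducibleSpace (QuiverVar D v₀ v) ↔ v₀ ≤ v ∧ v + v₀ ≤ finrank ℂ D) ∧
      (IsEmpty (QuiverVar D v₀ v) ↔ ¬ (v₀ ≤ v ∧ v + v₀ ≤ finrank ℂ D))) ∧
    -- the same for the multiplicity varieties
    (∀ v₀ : ℕ, (IrreducibleSpace (MultVar D₁ v₀ v₁ v₂) ↔
        v₁ + v₂ ≤ v₀ ∧ v₀ + v₂ ≤ finrank ℂ (D ⧸ D₁) + v₁ ∧ v₀ + v₁ ≤ finrank ℂ D₁ + v₂) ∧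
      (IsEmpty (MultVar D₁ v₀ v₁ v₂) ↔
        ¬ (v₁ + v₂ ≤ v₀ ∧ v₀ + v₂ ≤ finrank ℂ (D ⧸ D₁) + v₁ ∧
          v₀ + v₁ ≤ finrank ℂ D₁ + v₂))) ∧
    -- the factors are normal crystals
    (crystalM D₁ v₁).IsNormalCrystal ∧ (crystalM (D ⧸ D₁) v₂).IsNormalCrystal ∧
    (∀ v₀ : ℕ, (crystalM D v₀).IsNormalCrystal) ∧
    -- so are the two sides
    ((crystalM D₁ v₁).tensor (crystalM (D ⧸ D₁) v₂)).IsNormalCrystal ∧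
    (directSumCrystal fun v₀ : ℕ =>
      (trivialCrystal (SComp D₁ v₀ v₁ v₂)).tensor (crystalM D v₀)).IsNormalCrystal ∧
    -- the tensor decomposition bijection `τ = β ∘ α⁻¹`
    ∃ (α : TComp D₁ v₁ v₂ ≃ MComp D₁ v₁ × MComp (D ⧸ D₁) v₂)
      (β : TComp D₁ v₁ v₂ ≃ Σ v₀ : ℕ, SComp D₁ v₀ v₁ v₂ × MComp D v₀)
      (τ : (MComp D₁ v₁ × MComp (D ⧸ D₁) v₂) ≃ Σ v₀ : ℕ, SComp D₁ v₀ v₁ v₂ × MComp D v₀),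
      IsAlpha α ∧ IsBeta β ∧ τ = α.symm.trans β ∧
      -- it is a crystal isomorphism
      IsCrystalIso ((crystalM D₁ v₁).tensor (crystalM (D ⧸ D₁) v₂))
        (directSumCrystal fun v₀ : ℕ =>
          (trivialCrystal (SComp D₁ v₀ v₁ v₂)).tensor (crystalM D v₀)) τ ∧
      -- it sends the pair with weights `u₁`, `u₂` to `𝔐ˢ(d, v₀, u₁ + u₂)`
      ∀ (a : MComp D₁ v₁) (b : MComp (D ⧸ D₁) v₂),
        ((τ (a, b)).1 : ℤ) =
          min ((b.1 : ℤ) + v₁) ((finrank ℂ D₁ : ℤ) - a.1 + v₂) ∧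
        (τ (a, b)).2.2.1 = a.1 + b.1 ∧
        ((τ (a, b)).2.2.2 : Set (QuiverVar D (τ (a, b)).1 (τ (a, b)).2.2.1)) = Set.univ := by
  have hD := D₁.finrank_quotient_add_finrank
  obtain ⟨α, hα⟩ := exists_isAlpha D₁ v₁ v₂
  obtain ⟨β, hβ⟩ := exists_isBeta D₁ v₁ v₂
  refine ⟨fun v₀ v => irreducibleSpace_iff_and_isEmpty_iff (nonempty_quiverVar_iff v₀ v),
    fun v₀ => irreducibleSpace_iff_and_isEmpty_iff (nonempty_multVar_iff v₀),
    (crystalM_isRegular D₁ v₁).isNormalCrystal, (crystalM_isRegular (D ⧸ D₁) v₂).isNormalCrystal,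
    fun v₀ => (crystalM_isRegular D v₀).isNormalCrystal,
    crystalM_tensor_isRegular.isNormalCrystal, crystalSum_isRegular.isNormalCrystal,
    α, β, α.symm.trans β, hα, hβ, rfl, isCrystalIso_alpha_symm_trans_beta hα hβ, fun a b => ?_⟩
  have h1 := alpha_symm_trans_beta_spec hα hβ (a, b)
  have h2 := a.bounds
  dsimp only at h1
  exact ⟨by omega, h1.2, eq_univ_of_mem_irreducibleComponents (Subtype.property _)⟩
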